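/- Let $k$ be a field complete with respect to a non-archimedean absolute value, containing a field $k_0$ of characteristic zero on which the absolute value is trivial. Let $\lambda_1,\dots,\lambda_n\in k$ with $0<|\lambda_i|<1$, and let $$A=\mathrm{Sp}\,k\langle x_1,\lambda_1x_1^{-1},\dots,x_n,\lambda_nx_n^{-1}\rangle$$ be the polyannulus $\{|\lambda_i|\le |x_i|\le 1\}$, viewed as a Berkovich space, so that its points are the bounded multiplicative seminorms $g\mapsto |g(y)|$ on $\mathcal O(A)$, the algebra of Laurent series converging on $A$. Put $|g|_{\sup}=\sup_{y\in A}|g(y)|$. Its skeleton $\mathrm{Sk}(A)$ is the set of points $\sum_m c_m x^m\mapsto\max_m|c_m|r^m$ with $|\lambda_i|\le r_i\le 1$. Let $\frac{dx}{x}=\frac{dx_1}{x_1}\wedge\dots\wedge\frac{dx_n}{x_n}$. For a form $\omega$ of degree $n$ on $A$ let $\|\omega\|$ be Temkin's Kähler seminorm: its value at $y$ is the infimum of $\max_j|a_j|\,|b_{j,1}|\cdots|b_{j,n}|$ over the finite expressions $\sum_j a_j\,db_{j,1}\wedge\dots\wedge db_{j,n}$ of the value of $\omega$ in the $n$-forms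 over $k$ of the residue field of $y$. The skeleton $\mathrm{Sk}(\omega)\subset A$ is the locus where $\|\omega\|$ attains its maximum. Let $\omega=f\,\frac{dx}{x}$ be a volume form (a nowhere vanishing form of degree $n$) on $A$ with $\mathrm{Sk}(\omega)=\mathrm{Sk}(A)$. Then there are an automorphism $\varphi$ of $A$ over $k$ and a constant $c\in k$ with $$\varphi^*\Bigl(c\,\frac{dx}{x}\Bigr)=\omega ,$$ and $\varphi$ can be chosen of the form $$x_i\mapsto x_i\cdot\bigl(1+h_i(x_i,\dots,x_n)\bigr),\qquad i=1,\dots,n,$$ with $h_i\in\mathcal O(A)$, $|h_i|_{\sup}<1$, and $|1+h_i|$ identically $1$ on $A$. In particular $|\varphi^*x_i|=|x_i|$ on $A$, so $\varphi$ is compatible with the retraction of $A$ onto $\mathrm{Sk}(A)$; hence, if the form $\omega$ on one copy of $A$ and the form $c\,\frac{dx}{x}$ on another are given, the two copies can be glued along $\varphi$, compatibly with the retractions, so that the two forms patch. -/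

import Mathlib

open Filter Topology
open scoped NNReal

noncomputable section

set_option linter.unusedSectionVars false

namespace Polyannulus

universe u

section Carrier

variable {k : Type u} [NormedField k] {n : ℕ}

/-- The supremum of `|x^m|` on the polyannulus `|lam i| ≤ |x i| ≤ 1`. -/
def weight (lam : Fin n → k) (m : Fin n → ℤ) : ℝ := ∏ i, max 1 (‖lam i‖ ^ m i)

theorem one_le_weight (lam : Fin n → k) (m : Fin n → ℤ) : 1 ≤ weight lam m := by
  unfold weight
  calc (1 : ℝ) = ∏ _i : Fin n, (1 : ℝ) := by simp
    _ ≤ _ := Finset.prod_le_prod (fun _ _ => zero_le_one) (fun i _ => le_max_left _ _)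

theorem weight_nonneg (lam : Fin n → k) (m : Fin n → ℤ) : 0 ≤ weight lam m :=
  zero_le_one.trans (one_le_weight lam m)

theorem weight_zero (lam : Fin n → k) : weight lam 0 = 1 := by simp [weight]

theorem weight_add_le (lam : Fin n → k) (p q : Fin n → ℤ) :
    weight lam (p + q) ≤ weight lam p * weight lam q := by
  unfold weight
  rw [← Finset.prod_mul_distrib]
  refine Finset.prod_le_prod (fun i _ => zero_le_one.trans (le_max_left _ _)) (fun i _ => ?_)
  have h1 : (1 : ℝ) ≤ max 1 (‖lam i‖ ^ p i) := le_max_left _ _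
  have h2 : (1 : ℝ) ≤ max 1 (‖lam i‖ ^ q i) := le_max_left _ _
  refine max_le (one_le_mul_of_one_le_of_one_le h1 h2) ?_
  by_cases h0 : ‖lam i‖ = 0
  · rw [h0, Pi.add_apply]
    by_cases hz : p i + q i = 0
    · rw [hz, zpow_zero]
      exact one_le_mul_of_one_le_of_one_le (le_max_left _ _) (le_max_left _ _)
    · rw [zero_zpow _ hz]
      exact mul_nonneg (zero_le_one.trans (le_max_left _ _)) (zero_le_one.trans (le_max_left _ _))
  · rw [Pi.add_apply, zpow_add₀ h0]
    exact mul_le_mul (le_max_right _ _) (le_max_right _ _) (zpow_nonneg (norm_nonneg _) _)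
      (zero_le_one.trans h1)

/-- Families of coefficients `c m`, `m ∈ ℤ^n`, of Laurent series `∑ c m x^m` that converge on the
polyannulus: `|c m| * sup |x^m|` tends to zero. -/
def laurentModule (lam : Fin n → k) : Submodule k ((Fin n → ℤ) → k) where
  carrier := {c | Tendsto (fun m => ‖c m‖ * weight lam m) cofinite (𝓝 0)}
  zero_mem' := by
    change Tendsto (fun m => ‖(0 : k)‖ * weight lam m) cofinite (𝓝 0)
    simpa using tendsto_const_nhds
  add_mem' := by
    intro a b ha hb
    refine squeeze_zero (fun m => mul_nonneg (norm_nonneg _) (weight_nonneg lam m)) (fun m => ?_)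
      (by simpa using Tendsto.add ha hb)
    rw [← add_mul]
    exact mul_le_mul_of_nonneg_right (norm_add_le _ _) (weight_nonneg lam m)
  smul_mem' := by
    intro a b hb
    have := Tendsto.const_mul ‖a‖ hb
    simpa [mul_assoc] using this

/-- The affinoid algebra `O(A) = k⟨x_1, lam_1 x_1⁻¹, …, x_n, lam_n x_n⁻¹⟩` of the polyannulus `A`,
realised as the algebra of strictly convergent Laurent series. -/
def Alg (lam : Fin n → k) : Type u := ↥(laurentModule lam)

variable {lam : Fin n → k}

namespace Alg

/-- The coefficient of `x^m`. -/
def coeff (f : Alg lam) (m : Fin n → ℤ) : k := f.1 m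

@[ext] theorem ext {f g : Alg lam} (h : ∀ m, f.coeff m = g.coeff m) : f = g :=
  Subtype.ext (funext h)

instance : AddCommGroup (Alg lam) := inferInstanceAs (AddCommGroup (laurentModule lam))
instance : Module k (Alg lam) := inferInstanceAs (Module k (laurentModule lam))

@[simp] theorem coeff_zero (m : Fin n → ℤ) : (0 : Alg lam).coeff m = 0 := rfl
@[simp] theorem coeff_add (f g : Alg lam) (m : Fin n → ℤ) :
    (f + g).coeff m = f.coeff m + g.coeff m := rfl
@[simp] theorem coeff_neg (f : Alg lam) (m : Fin n → ℤ) : (-f).coeff m = -f.coeff m := rfl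
@[simp] theorem coeff_smul (a : k) (f : Alg lam) (m : Fin n → ℤ) :
    (a • f).coeff m = a * f.coeff m := rfl

theorem tendsto_coeff (f : Alg lam) :
    Tendsto (fun m => ‖f.coeff m‖ * weight lam m) cofinite (𝓝 0) := f.2

theorem finite_le (f : Alg lam) {ε : ℝ} (hε : 0 < ε) :
    {m | ε ≤ ‖f.coeff m‖ * weight lam m}.Finite := by
  have h := f.tendsto_coeff.eventually (gt_mem_nhds hε)
  simpa [Filter.eventually_cofinite] using h

/-- The norm `max_m |c m| * sup |x^m|`, which is the supremum norm on the polyannulus. -/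
instance : Norm (Alg lam) := ⟨fun f => ⨆ m, ‖f.coeff m‖ * weight lam m⟩

theorem norm_def (f : Alg lam) : ‖f‖ = ⨆ m, ‖f.coeff m‖ * weight lam m := rfl

theorem bddAbove (f : Alg lam) : BddAbove (Set.range fun m => ‖f.coeff m‖ * weight lam m) := by
  have hfin := f.finite_le one_pos
  obtain ⟨C, hC⟩ := (hfin.image (fun m => ‖f.coeff m‖ * weight lam m)).bddAbove
  refine ⟨max C 1, ?_⟩
  rintro _ ⟨m, rfl⟩
  by_cases h : 1 ≤ ‖f.coeff m‖ * weight lam m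
  · exact (hC ⟨m, h, rfl⟩).trans (le_max_left _ _)
  · exact (not_le.mp h).le.trans (le_max_right _ _)

theorem le_norm (f : Alg lam) (m : Fin n → ℤ) : ‖f.coeff m‖ * weight lam m ≤ ‖f‖ :=
  le_ciSup f.bddAbove m

theorem norm_nonneg' (f : Alg lam) : 0 ≤ ‖f‖ :=
  (mul_nonneg (norm_nonneg _) (weight_nonneg lam 0)).trans (f.le_norm 0)

/-- The monomial `a * x^m`. -/
def monomial (m : Fin n → ℤ) (a : k) : Alg lam :=
  ⟨fun p => if p = m then a else 0, by
    refine tendsto_nhds_of_eventually_eq ?_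
    rw [Filter.eventually_cofinite]
    refine (Set.finite_singleton m).subset (fun p hp => ?_)
    by_contra h
    have h' : p ≠ m := h
    simp [h'] at hp⟩

theorem coeff_monomial (m : Fin n → ℤ) (a : k) (p : Fin n → ℤ) :
    (monomial m a : Alg lam).coeff p = if p = m then a else 0 := rfl

end Alg

end Carrier

section Ring

variable {k : Type u} [NormedField k] [IsUltrametricDist k] [CompleteSpace k] {n : ℕ}
  {lam : Fin n → k}

namespace Alg

theorem finite_prod_le (f g : Alg lam) {ε : ℝ} (hε : 0 < ε) :
    {s : (Fin n → ℤ) × (Fin n → ℤ) | ε ≤ (‖f.coeff s.1‖ * weight lam s.1) *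
      (‖g.coeff s.2‖ * weight lam s.2)}.Finite := by
  set F := ‖f‖ + 1
  set G := ‖g‖ + 1
  have hF : 0 < F := by have := f.norm_nonneg'; positivity
  have hG : 0 < G := by have := g.norm_nonneg'; positivity
  refine ((f.finite_le (div_pos hε hG)).prod (g.finite_le (div_pos hε hF))).subset ?_
  rintro ⟨p, q⟩ h
  have h' : ε ≤ (‖f.coeff p‖ * weight lam p) * (‖g.coeff q‖ * weight lam q) := h
  have a0 : 0 ≤ ‖f.coeff p‖ * weight lam p := mul_nonneg (norm_nonneg _) (weight_nonneg lam p)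
  have b0 : 0 ≤ ‖g.coeff q‖ * weight lam q := mul_nonneg (norm_nonneg _) (weight_nonneg lam q)
  have a1 : ‖f.coeff p‖ * weight lam p ≤ F := (f.le_norm p).trans (by simp [F])
  have b1 : ‖g.coeff q‖ * weight lam q ≤ G := (g.le_norm q).trans (by simp [G])
  refine ⟨?_, ?_⟩
  · exact (div_le_iff₀ hG).2 (h'.trans (mul_le_mul_of_nonneg_left b1 a0))
  · refine (div_le_iff₀ hF).2 (h'.trans ?_)
    rw [mul_comm]
    exact mul_le_mul_of_nonneg_left a1 b0

theorem tendsto_prod (f g : Alg lam) :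
    Tendsto (fun s : (Fin n → ℤ) × (Fin n → ℤ) => f.coeff s.1 * g.coeff s.2) cofinite (𝓝 0) := by
  rw [tendsto_zero_iff_norm_tendsto_zero, Metric.tendsto_nhds]
  intro ε hε
  rw [Filter.eventually_cofinite]
  refine (f.finite_prod_le g hε).subset (fun s hs => ?_)
  have hs' : ε ≤ ‖f.coeff s.1‖ * ‖g.coeff s.2‖ := by simpa using hs
  refine hs'.trans (mul_le_mul ?_ ?_ (norm_nonneg _) ?_)
  · exact le_mul_of_one_le_right (norm_nonneg _) (one_le_weight lam _)
  · exact le_mul_of_one_le_right (norm_nonneg _) (one_le_weight lam _)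
  · exact mul_nonneg (norm_nonneg _) (weight_nonneg lam _)

theorem shear_injective : Function.Injective
    (fun s : (Fin n → ℤ) × (Fin n → ℤ) => (s.2, s.1 - s.2)) := by
  rintro ⟨a, b⟩ ⟨c, d⟩ h
  simp only [Prod.mk.injEq] at h
  obtain ⟨rfl, h⟩ := h
  simpa using h

theorem summable_conv (f g : Alg lam) (m : Fin n → ℤ) :
    Summable (fun p => f.coeff p * g.coeff (m - p)) := by
  refine NonarchimedeanAddGroup.summable_of_tendsto_cofinite_zero ?_
  have hi : Function.Injective (fun p : Fin n → ℤ => (p, m - p)) := fun a b h => by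
    simpa using congrArg Prod.fst h
  exact (f.tendsto_prod g).comp hi.tendsto_cofinite

theorem norm_conv_le (f g : Alg lam) (m : Fin n → ℤ) {C : ℝ} (hC : 0 ≤ C)
    (h : ∀ p, (‖f.coeff p‖ * weight lam p) * (‖g.coeff (m - p)‖ * weight lam (m - p)) ≤ C) :
    ‖∑' p, f.coeff p * g.coeff (m - p)‖ * weight lam m ≤ C := by
  have hw : 0 < weight lam m := zero_lt_one.trans_le (one_le_weight lam m)
  rw [← le_div_iff₀ hw]
  refine IsUltrametricDist.norm_tsum_le_of_forall_le_of_nonneg (div_nonneg hC hw.le) (fun p => ?_)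
  rw [le_div_iff₀ hw, norm_mul]
  refine le_trans ?_ (h p)
  have hw' : weight lam m ≤ weight lam p * weight lam (m - p) := by
    simpa using weight_add_le lam p (m - p)
  calc ‖f.coeff p‖ * ‖g.coeff (m - p)‖ * weight lam m
      ≤ ‖f.coeff p‖ * ‖g.coeff (m - p)‖ * (weight lam p * weight lam (m - p)) :=
        mul_le_mul_of_nonneg_left hw' (by positivity)
    _ = _ := by ring

/-- The Cauchy product of Laurent series. -/
instance : Mul (Alg lam) := ⟨fun f g => ⟨fun m => ∑' p, f.coeff p * g.coeff (m - p), by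
  change Tendsto _ cofinite (𝓝 0)
  rw [Metric.tendsto_nhds]
  intro ε hε
  rw [Filter.eventually_cofinite]
  refine ((f.finite_prod_le g (half_pos hε)).image (fun s => s.1 + s.2)).subset (fun m hm => ?_)
  by_contra hcon
  refine hm ?_
  have key : ‖∑' p, f.coeff p * g.coeff (m - p)‖ * weight lam m ≤ ε / 2 := by
    refine norm_conv_le f g m (half_pos hε).le (fun p => ?_)
    by_contra hp
    exact hcon ⟨(p, m - p), (not_le.mp hp).le, by simp⟩
  have h0 : 0 ≤ ‖∑' p, f.coeff p * g.coeff (m - p)‖ * weight lam m :=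
    mul_nonneg (norm_nonneg _) (weight_nonneg lam m)
  rw [Real.dist_eq, sub_zero, abs_of_nonneg h0]
  linarith⟩⟩

theorem coeff_mul (f g : Alg lam) (m : Fin n → ℤ) :
    (f * g).coeff m = ∑' p, f.coeff p * g.coeff (m - p) := rfl

instance : One (Alg lam) := ⟨monomial 0 1⟩

theorem coeff_one (m : Fin n → ℤ) : (1 : Alg lam).coeff m = if m = 0 then 1 else 0 := rfl

theorem mul_comm' (f g : Alg lam) : f * g = g * f := by
  ext m
  rw [coeff_mul, coeff_mul, ← (Equiv.subLeft m).tsum_eq]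
  refine tsum_congr (fun p => ?_)
  simp [mul_comm]

theorem one_mul' (f : Alg lam) : 1 * f = f := by
  ext m
  rw [coeff_mul, tsum_eq_single 0 (fun p hp => by simp [coeff_one, hp])]
  simp [coeff_one]

theorem mul_add' (f g h : Alg lam) : f * (g + h) = f * g + f * h := by
  ext m
  rw [coeff_add, coeff_mul, coeff_mul, coeff_mul,
    ← (summable_conv f g m).tsum_add (summable_conv f h m)]
  exact tsum_congr (fun p => by simp [mul_add])

theorem mul_assoc' (f g h : Alg lam) : f * g * h = f * (g * h) := by
  ext m
  have hs : Summable (fun s : (Fin n → ℤ) × (Fin n → ℤ) =>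
      f.coeff s.2 * g.coeff (s.1 - s.2) * h.coeff (m - s.1)) := by
    refine NonarchimedeanAddGroup.summable_of_tendsto_cofinite_zero ?_
    have h1 := (f.tendsto_prod g).comp (shear_injective (n := n)).tendsto_cofinite
    rw [tendsto_zero_iff_norm_tendsto_zero] at h1 ⊢
    have h2 := h1.mul_const ‖h‖
    rw [zero_mul] at h2
    refine squeeze_zero (fun _ => norm_nonneg _) (fun s => ?_) h2
    rw [norm_mul]
    refine mul_le_mul_of_nonneg_left ?_ (norm_nonneg _)
    exact (le_mul_of_one_le_right (norm_nonneg _) (one_le_weight lam _)).trans (h.le_norm _)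
  calc (f * g * h).coeff m
      = ∑' p, ∑' s, f.coeff s * g.coeff (p - s) * h.coeff (m - p) := by
        rw [coeff_mul]
        refine tsum_congr (fun p => ?_)
        rw [coeff_mul, tsum_mul_right]
    _ = ∑' s, ∑' p, f.coeff s * g.coeff (p - s) * h.coeff (m - p) := by
        refine Summable.tsum_comm (f := fun s p => f.coeff s * g.coeff (p - s) * h.coeff (m - p)) ?_
        exact (Equiv.prodComm _ _).summable_iff.1 hs
    _ = (f * (g * h)).coeff m := by
        rw [coeff_mul]
        refine tsum_congr (fun s => ?_)
        rw [coeff_mul, ← tsum_mul_left, ← (Equiv.addRight s).tsum_eq]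
        refine tsum_congr (fun q => ?_)
        simp only [Equiv.coe_addRight, add_sub_cancel_right, mul_assoc]
        congr 3
        abel

instance : CommRing (Alg lam) where
  __ := (inferInstance : AddCommGroup (Alg lam))
  mul := (· * ·)
  one := 1
  mul_comm := mul_comm'
  one_mul := one_mul'
  mul_one f := by rw [mul_comm', one_mul']
  mul_assoc := mul_assoc'
  left_distrib := mul_add'
  right_distrib f g h := by rw [mul_comm', mul_add', mul_comm' h, mul_comm' h]
  zero_mul f := by ext m; rw [coeff_mul]; simp
  mul_zero f := by ext m; rw [coeff_mul]; simp

instance : Algebra k (Alg lam) := Algebra.ofModule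
  (fun a f g => by
    ext m
    rw [coeff_mul, coeff_smul, coeff_mul, ← tsum_mul_left]
    exact tsum_congr (fun p => by simp [mul_assoc]))
  (fun a f g => by
    ext m
    rw [coeff_mul, coeff_smul, coeff_mul, ← tsum_mul_left]
    exact tsum_congr (fun p => by simp [mul_left_comm]))

/-- The norm of `O(A)` as a ring norm. -/
def ringNorm (lam : Fin n → k) : RingNorm (Alg lam) where
  toFun f := ‖f‖
  map_zero' := by simp [norm_def]
  add_le' f g := by
    rw [norm_def (f + g)]
    refine ciSup_le (fun m => ?_)
    refine (mul_le_mul_of_nonneg_right (norm_add_le _ _) (weight_nonneg lam m)).trans ?_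
    rw [add_mul]
    exact add_le_add (f.le_norm m) (g.le_norm m)
  neg' f := by simp [norm_def]
  mul_le' f g := by
    rw [norm_def (f * g)]
    refine ciSup_le (fun m => norm_conv_le f g m (mul_nonneg f.norm_nonneg' g.norm_nonneg')
      (fun p => ?_))
    exact mul_le_mul (f.le_norm p) (g.le_norm _)
      (mul_nonneg (norm_nonneg _) (weight_nonneg lam _)) f.norm_nonneg'
  eq_zero_of_map_eq_zero' f hf := by
    ext m
    have h1 : ‖f.coeff m‖ * weight lam m ≤ 0 := (f.le_norm m).trans (le_of_eq hf)
    have h2 : ‖f.coeff m‖ ≤ ‖f.coeff m‖ * weight lam m :=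
      le_mul_of_one_le_right (norm_nonneg _) (one_le_weight lam m)
    simpa using h2.trans h1

instance : NormedCommRing (Alg lam) where
  __ := (ringNorm lam).toNormedRing
  mul_comm := mul_comm'

/-- The coordinate function `x_i`. -/
def X (lam : Fin n → k) (i : Fin n) : Alg lam := monomial (Pi.single i 1) 1

/-- The inverse `x_i⁻¹` of the coordinate function. -/
def Xinv (lam : Fin n → k) (i : Fin n) : Alg lam := monomial (-Pi.single i 1) 1

theorem X_mul_Xinv (i : Fin n) : X lam i * Xinv lam i = 1 := by
  ext m
  rw [coeff_mul, tsum_eq_single (Pi.single i 1) (fun p hp => by simp [X, coeff_monomial, hp])]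
  have : m - Pi.single i 1 = -Pi.single i 1 ↔ m = 0 := by
    rw [sub_eq_iff_eq_add, neg_add_cancel]
  simp [X, Xinv, coeff_monomial, coeff_one, this]

/-- `f` is a function `f(x_i, …, x_n)`: no `x_j` with `j < i` occurs in its expansion. -/
def DependsOnlyFrom (i : Fin n) (f : Alg lam) : Prop :=
  ∀ m : Fin n → ℤ, (∃ j, j < i ∧ m j ≠ 0) → f.coeff m = 0

/-- The logarithmic derivative operator `x_i ∂/∂x_i`, multiplying the coefficient of `x^m`
by `m i`. -/
def theta (i : Fin n) : Alg lam →ₗ[k] Alg lam where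
  toFun f := ⟨fun m => (m i : k) * f.coeff m, by
    refine squeeze_zero (fun m => mul_nonneg (norm_nonneg _) (weight_nonneg lam m)) (fun m => ?_)
      f.tendsto_coeff
    refine mul_le_mul_of_nonneg_right ?_ (weight_nonneg lam m)
    rw [norm_mul]
    exact mul_le_of_le_one_left (norm_nonneg _) (IsUltrametricDist.norm_intCast_le_one k (m i))⟩
  map_add' f g := ext fun m => mul_add _ _ _
  map_smul' a f := ext fun m => mul_left_comm _ _ _

theorem coeff_theta (i : Fin n) (f : Alg lam) (m : Fin n → ℤ) :
    (theta i f).coeff m = (m i : k) * f.coeff m := rfl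

theorem theta_mul (i : Fin n) (f g : Alg lam) :
    theta i (f * g) = f * theta i g + g * theta i f := by
  ext m
  rw [mul_comm g, coeff_add, coeff_theta, coeff_mul, coeff_mul, coeff_mul, ← tsum_mul_left,
    ← (summable_conv f (theta i g) m).tsum_add (summable_conv (theta i f) g m)]
  refine tsum_congr (fun p => ?_)
  simp only [coeff_theta, Pi.sub_apply, Int.cast_sub]
  ring

end Alg

/-- The module of (analytic) differential `1`-forms on the polyannulus, free over `O(A)` on
`dx_1/x_1, …, dx_n/x_n`: the tuple `g` stands for `∑ i, g i • dx_i/x_i`. -/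
abbrev OneForm (lam : Fin n → k) : Type u := Fin n → Alg lam

/-- The exterior differential `d f = ∑ i, x_i (∂f/∂x_i) dx_i/x_i`. -/
def d (lam : Fin n → k) : Derivation k (Alg lam) (OneForm lam) :=
  Derivation.mk' (LinearMap.pi fun i => Alg.theta i) (fun f g => by
    funext i
    exact Alg.theta_mul i f g)

/-- Differential forms of top degree `n` on the `n`-dimensional polyannulus. -/
abbrev TopForm (lam : Fin n → k) : Type u := ⋀[Alg lam]^n (OneForm lam)

/-- The standard volume form `dx/x = dx_1/x_1 ∧ … ∧ dx_n/x_n`. -/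
def stdForm (lam : Fin n → k) : TopForm lam :=
  exteriorPower.ιMulti (Alg lam) n (fun i => Alg.Xinv lam i • d lam (Alg.X lam i))

/-- A volume form is a nowhere vanishing form of top degree, that is, one that generates the
(invertible) module of forms of top degree. -/
def IsVolumeForm (ω : TopForm lam) : Prop := Submodule.span (Alg lam) {ω} = ⊤

/-- The coefficient `f` of a form `ω = f dx/x` of top degree. -/
def formCoeff (lam : Fin n → k) : TopForm lam →ₗ[Alg lam] Alg lam :=
  exteriorPower.alternatingMapLinearEquiv Matrix.detRowAlternating

theorem dlog_X (i : Fin n) :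
    (Alg.Xinv lam i • d lam (Alg.X lam i) : OneForm lam) = Pi.single i 1 := by
  have h : ∀ j, (d lam (Alg.X lam i)) j = (if j = i then 1 else 0 : Alg lam) * Alg.X lam i := by
    intro j
    change Alg.theta j (Alg.X lam i) = _
    ext m
    rw [Alg.coeff_theta, Alg.X, Alg.coeff_monomial]
    by_cases hm : m = Pi.single i 1
    · subst hm
      by_cases hj : j = i
      · subst hj
        simp [Alg.coeff_monomial]
      · simp [hj]
    · by_cases hj : j = i
      · simp [hj, hm, Alg.coeff_monomial]
      · simp [hj, hm]
  funext j
  rw [Pi.smul_apply, h j, smul_eq_mul, mul_left_comm, mul_comm (Alg.Xinv lam i), Alg.X_mul_Xinv,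
    mul_one, Pi.single_apply]

theorem formCoeff_stdForm : formCoeff lam (stdForm lam) = 1 := by
  rw [formCoeff, stdForm, exteriorPower.alternatingMapLinearEquiv_apply_ιMulti]
  simp only [dlog_X]
  rw [show (fun i => Pi.single i 1 : Fin n → OneForm lam) =
    (fun i => (1 : Matrix (Fin n) (Fin n) (Alg lam)) i) from by
      funext i j
      rw [Matrix.one_apply, Pi.single_apply]
      simp only [eq_comm]]
  exact Matrix.det_one

/-- Every form of top degree is `f dx/x` for its coefficient `f`. -/
theorem formCoeff_smul_stdForm (ω : TopForm lam) : formCoeff lam ω • stdForm lam = ω := by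
  have h : (LinearMap.toSpanSingleton (Alg lam) (TopForm lam) (stdForm lam)) ∘ₗ formCoeff lam
      = LinearMap.id := by
    refine exteriorPower.linearMap_ext ?_
    refine Module.Basis.ext_alternating (Pi.basisFun (Alg lam) (Fin n)) (fun v hv => ?_)
    obtain ⟨σ, rfl⟩ : ∃ σ : Equiv.Perm (Fin n), v = σ :=
      ⟨Equiv.ofBijective v (Finite.injective_iff_bijective.1 hv), rfl⟩
    have e : (fun i => Pi.basisFun (Alg lam) (Fin n) (σ i)) =
        (fun i => (Alg.Xinv lam i • d lam (Alg.X lam i) : OneForm lam)) ∘ σ := by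
      funext i
      simp [dlog_X]
    rw [e, AlternatingMap.map_perm, AlternatingMap.map_perm]
    congr 1
    change formCoeff lam (stdForm lam) • stdForm lam = stdForm lam
    rw [formCoeff_stdForm, one_smul]
  exact LinearMap.congr_fun h ω

/-- The pullback of forms of top degree along the morphism `A → A` given by `φ : O(A) → O(A)`:
`φ^*(f dx_1/x_1 ∧ … ∧ dx_n/x_n) = φ(f) dφ(x_1)/φ(x_1) ∧ … ∧ dφ(x_n)/φ(x_n)`. -/
def pullback (φ : Alg lam →ₐ[k] Alg lam) (ω : TopForm lam) : TopForm lam :=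
  φ (formCoeff lam ω) •
    exteriorPower.ιMulti (Alg lam) n (fun i => φ (Alg.Xinv lam i) • d lam (φ (Alg.X lam i)))

/-- The points of the Berkovich space `A = M(O(A))`: bounded multiplicative seminorms on `O(A)`.
As `k` is non-archimedean, these satisfy the ultrametric inequality, so they are
valuations with values in `ℝ≥0`; being bounded they restrict to the absolute value of `k`. -/
structure Point (lam : Fin n → k) where
  /-- the multiplicative seminorm `f ↦ |f(y)|` -/
  val : Valuation (Alg lam) ℝ≥0
  /-- boundedness -/
  bounded : ∃ C : ℝ, ∀ f, (val f : ℝ) ≤ C * ‖f‖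

/-- The supremum seminorm `sup_{y ∈ A} |f(y)|`. -/
def supNorm (f : Alg lam) : ℝ≥0 := ⨆ y : Point lam, y.val f

/-- The skeleton of the polyannulus: the weighted Gauss points `∑ c_m x^m ↦ max |c_m| r^m`
with `|lam i| ≤ r i ≤ 1`. -/
def skeleton (lam : Fin n → k) : Set (Point lam) :=
  {y | ∃ r : Fin n → ℝ, (∀ i, ‖lam i‖ ≤ r i ∧ r i ≤ 1) ∧
    ∀ f, (y.val f : ℝ) = ⨆ m, ‖f.coeff m‖ * ∏ i, r i ^ m i}

end Ring

section Kahler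

/-- The Kähler seminorm of Temkin on `n`-forms of a valued extension `K` of `k`: the infimum of
`max_j |a_j| |b_{j,1}| ⋯ |b_{j,n}|` over all expressions `∑ a_j db_{j,1} ∧ … ∧ db_{j,n}` of the
form. -/
def kahlerSeminorm (k : Type*) {K : Type*} [Field k] [Field K] [Algebra k K]
    (v : Valuation K ℝ≥0) (n : ℕ) (η : ⋀[K]^n (Ω[K⁄k])) : ℝ≥0 :=
  sInf {C | ∃ (N : ℕ) (a : Fin N → K) (b : Fin N → Fin n → K),
    η = ∑ j, a j • exteriorPower.ιMulti K n (fun i => KaehlerDifferential.D k K (b j i)) ∧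
    ∀ j, v (a j) * ∏ i, v (b j i) ≤ C}

variable {k : Type u} [NormedField k] [IsUltrametricDist k] [CompleteSpace k] {n : ℕ}
  {lam : Fin n → k}

namespace Point

/-- The field generated by the values of functions at `y`, namely the fraction field of `O(A)`
modulo the functions vanishing at `y`. It is dense in the complete residue field `H(y)`, and
passing to the completion does not change Kähler seminorms. -/
abbrev ResField (y : Point lam) : Type u := FractionRing (Alg lam ⧸ y.val.supp)

/-- The value `f(y)`. -/
def eval (y : Point lam) : Alg lam →ₐ[k] y.ResField :=
  (IsScalarTower.toAlgHom k (Alg lam ⧸ y.val.supp) y.ResField).comp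
    (Ideal.Quotient.mkₐ k y.val.supp)

theorem nonZeroDivisors_le (y : Point lam) :
    nonZeroDivisors (Alg lam ⧸ y.val.supp) ≤ (y.val.onQuot le_rfl).supp.primeCompl := by
  intro a ha h
  have h' : a ∈ (y.val.onQuot le_rfl).supp := h
  rw [Valuation.supp_quot_supp] at h'
  exact nonZeroDivisors.ne_zero ha h'

/-- The absolute value of the residue field. -/
def resVal (y : Point lam) : Valuation y.ResField ℝ≥0 :=
  (y.val.onQuot le_rfl).extendToLocalization y.nonZeroDivisors_le y.ResField

theorem resVal_eval (y : Point lam) (f : Alg lam) : y.resVal (y.eval f) = y.val f := by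
  change ((y.val.onQuot le_rfl).extendToLocalization y.nonZeroDivisors_le y.ResField)
    (algebraMap (Alg lam ⧸ y.val.supp) y.ResField (Ideal.Quotient.mk y.val.supp f)) = _
  exact Valuation.extendToLocalization_apply_map_apply (y.val.onQuot le_rfl) y.nonZeroDivisors_le
    y.ResField (Ideal.Quotient.mk y.val.supp f)

/-- The value at `y` of a form of top degree, as a form on the residue field:
`f dx_1/x_1 ∧ … ∧ dx_n/x_n` goes to
`f(y) dx_1(y)/x_1(y) ∧ … ∧ dx_n(y)/x_n(y)`. -/
def evalForm (y : Point lam) (ω : TopForm lam) : ⋀[y.ResField]^n (Ω[y.ResField⁄k]) :=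
  y.eval (formCoeff lam ω) •
    exteriorPower.ιMulti y.ResField n (fun i =>
      y.eval (Alg.Xinv lam i) • KaehlerDifferential.D k y.ResField (y.eval (Alg.X lam i)))

/-- The Kähler seminorm `‖ω‖` at `y`. -/
def formNorm (y : Point lam) (ω : TopForm lam) : ℝ≥0 :=
  kahlerSeminorm k y.resVal n (y.evalForm ω)

end Point

/-- The skeleton `Sk(ω)` of a form of top degree: the locus where `‖ω‖` is maximal. -/
def formSkeleton (ω : TopForm lam) : Set (Point lam) :=
  {y | ∀ z : Point lam, z.formNorm ω ≤ y.formNorm ω}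

end Kahler

end Polyannulus

end

/-!
The volume form `f dx/x` has invertible coefficient `f`, and the proof shows that, after division by
its constant term `c`, this coefficient is close to `1` and can be integrated one variable at a
time.

At the Gauss point of radius `r` the operators `x_i ∂/∂x_i` do not increase absolute values, and no
nonzero function vanishes. They extend to derivations of the residue field, and contracting with
them bounds the Kähler seminorm from below (`le_kahlerSeminorm`), so that `‖f dx/x‖ = |f|_r` there
(`Point.formNorm_eq`). The hypothesis on the skeleton therefore says that the Gauss norm `|f|_r`
does not depend on `r`. Gauss norms are multiplicative since `ℤ^n` has unique sums; the stronger
property of two unique sums shows that a unit has exactly one dominant exponent at each radius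
(`Alg.dominant_subsingleton`). If the Gauss norms are constant in `r`, this exponent is `0` at every
vertex of the box of radii, and hence `‖f - c‖ < |c|` (`Alg.norm_sub_coeff_zero_lt`).

Write `f = c (1 + a)` with `‖a‖ < 1`. The part of `1 + a` in the variables `x_i, …, x_n` divided by
its part in `x_{i+1}, …, x_n` is `1 + g_i`, where every term of `g_i` involves `x_i`. As nonzero
integers have absolute value `1` in `k`, there is `w_i` with `x_i ∂w_i/∂x_i = g_i` and `‖w_i‖ < 1`,
and `1 + h_i = exp w_i` converges (`Alg.exists_exp`). The product of the `1 + g_i` telescopes to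
`1 + a` (`Alg.exists_prod_eq`).

The substitution `x_i ↦ x_i (1 + h_i)` differs from the identity by a map of norm less than `1`, so
it is an automorphism (`Alg.exists_substitution`). Its logarithmic Jacobian matrix is triangular
with diagonal entries `1 + g_i`, so it pulls `c dx/x` back to `c (1 + a) dx/x = f dx/x`
(`pullback_smul_stdForm`).
-/

noncomputable section

set_option linter.unusedSectionVars false

namespace Polyannulus

universe u

/-! ### Derivations and the Kähler seminorm -/

section Derivations

/-- A derivation of a domain extends to its field of fractions. The extension is read off from the
algebra homomorphism `a ↦ a + (D a) ε` to the dual numbers over the field. -/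
theorem exists_derivation_extension {k A K : Type*} [Field k] [CommRing A] [Field K] [Algebra k A]
    [Algebra k K] (e : A →ₐ[k] K) (he : Function.Injective e)
    (hfrac : ∀ z : K, ∃ a b : A, e b ≠ 0 ∧ z * e b = e a) (D : Derivation k A A) :
    ∃ D' : Derivation k K K, ∀ a, D' (e a) = e (D a) := by
  let _ : Algebra A K := e.toRingHom.toAlgebra
  have halg : ∀ a, algebraMap A K a = e a := fun _ => rfl
  have : IsScalarTower k A K := IsScalarTower.of_algebraMap_eq fun c => (e.commutes c).symm
  have : IsDomain A := he.isDomain e.toRingHom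
  have : IsLocalization (nonZeroDivisors A) K :=
    { map_units := fun s => by
        refine isUnit_iff_ne_zero.2 (fun h => nonZeroDivisors.ne_zero s.2 (he ?_))
        rw [map_zero]
        exact h
      surj := fun z => by
        obtain ⟨a, b, hb, h⟩ := hfrac z
        have hb' : b ≠ 0 := by rintro rfl; simp at hb
        exact ⟨(a, ⟨b, mem_nonZeroDivisors_of_ne_zero hb'⟩), h⟩
      exists_of_eq := fun {x y} h => ⟨1, by rw [he h]⟩ }
  let g : A →ₐ[k] DualNumber K :=
    AlgHom.ofLinearMap
      { toFun := fun a => TrivSqZeroExt.inl (e a) + TrivSqZeroExt.inr (e (D a))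
        map_add' := fun a b => by ext <;> simp
        map_smul' := fun c a => by ext <;> simp }
      (by ext <;> simp)
      (fun a b => by ext <;> simp [mul_comm, add_comm])
  have hgfst : ∀ a, (g a).fst = e a := fun a => by simp [g]
  have hgsnd : ∀ a, (g a).snd = e (D a) := fun a => by simp [g]
  have hg : ∀ s : nonZeroDivisors A, IsUnit (g s) := fun s => by
    rw [TrivSqZeroExt.isUnit_iff_isUnit_fst, hgfst]
    exact IsLocalization.map_units K s
  let Φ : K →ₐ[k] DualNumber K := IsLocalization.liftAlgHom (M := nonZeroDivisors A) (f := g) hg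
  have hΦ : ∀ a, Φ (e a) = g a := fun a => IsLocalization.lift_eq hg a
  have hfst : ∀ z, (Φ z).fst = z := by
    intro z
    obtain ⟨a, b, hb, h⟩ := hfrac z
    refine mul_right_cancel₀ hb ?_
    have := congrArg TrivSqZeroExt.fst (congrArg Φ h)
    rw [map_mul, TrivSqZeroExt.fst_mul, hΦ, hΦ, hgfst, hgfst] at this
    rw [this, h]
  refine ⟨Derivation.mk'
    { toFun := fun z => (Φ z).snd
      map_add' := fun x y => by simp
      map_smul' := fun c x => by simp } (fun x y => ?_), fun a => ?_⟩
  · change (Φ (x * y)).snd = x • (Φ y).snd + y • (Φ x).snd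
    rw [map_mul, TrivSqZeroExt.snd_mul, hfst, hfst, op_smul_eq_smul]
  · exact (congrArg TrivSqZeroExt.snd (hΦ a)).trans (hgsnd a)

variable {k K : Type*} [Field k] [Field K] [Algebra k K] {n : ℕ}

/-- The contraction of `n`-forms with the derivations `D_1, …, D_n`, sending
`a db_1 ∧ … ∧ db_n` to `a det (D_j b_i)`. -/
def contraction (D : Fin n → Derivation k K K) : ⋀[K]^n (Ω[K⁄k]) →ₗ[K] K :=
  exteriorPower.alternatingMapLinearEquiv (Matrix.detRowAlternating.compLinearMap
    (LinearMap.pi fun l => (D l).liftKaehlerDifferential))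

theorem contraction_ιMulti (D : Fin n → Derivation k K K) (ξ : Fin n → Ω[K⁄k]) :
    contraction D (exteriorPower.ιMulti K n ξ) =
      Matrix.det (Matrix.of fun i l => (D l).liftKaehlerDifferential (ξ i)) := by
  rw [contraction, exteriorPower.alternatingMapLinearEquiv_apply_ιMulti]
  rfl

/-- Contraction with derivations that do not increase absolute values is bounded by the Kähler
seminorm. A presentation of the form is required since the infimum over the empty set is `0`. -/
theorem le_kahlerSeminorm (v : Valuation K ℝ≥0) (D : Fin n → Derivation k K K)
    (hD : ∀ l b, v (D l b) ≤ v b) (η : ⋀[K]^n (Ω[K⁄k]))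
    (hη : ∃ (N : ℕ) (a : Fin N → K) (b : Fin N → Fin n → K),
      η = ∑ j, a j • exteriorPower.ιMulti K n (fun i => KaehlerDifferential.D k K (b j i))) :
    v (contraction D η) ≤ kahlerSeminorm k v n η := by
  refine le_csInf ?_ ?_
  -- the sum of the terms of a presentation bounds their maximum
  · obtain ⟨N, a, b, h⟩ := hη
    exact ⟨∑ j, v (a j) * ∏ i, v (b j i), N, a, b, h, fun j =>
      Finset.single_le_sum (f := fun j => v (a j) * ∏ i, v (b j i)) (fun _ _ => zero_le)
        (Finset.mem_univ j)⟩
  · rintro C ⟨N, a, b, rfl, hC⟩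
    rw [map_sum]
    refine v.map_sum_le (fun j _ => ?_)
    rw [map_smul, smul_eq_mul, map_mul]
    refine le_trans ?_ (hC j)
    gcongr
    rw [contraction_ιMulti, Matrix.det_apply]
    refine v.map_sum_le (fun σ _ => ?_)
    rw [Units.smul_def, zsmul_eq_mul, map_mul, map_prod]
    have hs : v (((σ.sign : ℤ)) : K) = 1 := by
      rcases Int.units_eq_one_or σ.sign with h | h <;> simp [h, Valuation.map_neg]
    rw [hs, one_mul, ← Equiv.prod_comp σ (fun i => v (b j i))]
    refine Finset.prod_le_prod' (fun i _ => ?_)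
    simpa using hD i (b j (σ i))

end Derivations

/-! ### The Banach algebra of Laurent series -/

section Families

variable {ι : Type*}

theorem exists_forall_le_of_tendsto_cofinite_zero [Nonempty ι] {a : ι → ℝ} (h0 : ∀ i, 0 ≤ a i)
    (ha : Tendsto a cofinite (𝓝 0)) : ∃ i, ∀ j, a j ≤ a i := by
  by_cases hz : ∀ i, a i = 0
  · exact ⟨Classical.arbitrary ι, fun j => by simp [hz]⟩
  · push Not at hz
    obtain ⟨i₀, hi₀⟩ := hz
    have hpos : 0 < a i₀ := lt_of_le_of_ne (h0 i₀) (Ne.symm hi₀)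
    have hfin : {i | a i₀ ≤ a i}.Finite := by
      simpa [Filter.eventually_cofinite] using ha.eventually (gt_mem_nhds hpos)
    obtain ⟨i, hi, hmax⟩ := hfin.exists_maximalFor a _ ⟨i₀, le_refl (a i₀)⟩
    refine ⟨i, fun j => ?_⟩
    by_cases hj : a i₀ ≤ a j
    · rcases le_total (a i) (a j) with h | h
      · exact hmax hj h
      · exact h
    · exact (not_le.1 hj).le.trans hi

theorem norm_tsum_lt {E : Type*} [NormedAddCommGroup E] [IsUltrametricDist E]
    {g : ι → E} (hg : Tendsto g cofinite (𝓝 0)) {C : ℝ} (hC : 0 < C) (h : ∀ i, ‖g i‖ < C) :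
    ‖∑' i, g i‖ < C := by
  rcases isEmpty_or_nonempty ι with hι | hι
  · simpa using hC
  obtain ⟨i, hi⟩ := exists_forall_le_of_tendsto_cofinite_zero (fun i => norm_nonneg (g i))
    (tendsto_zero_iff_norm_tendsto_zero.1 hg)
  exact (IsUltrametricDist.norm_tsum_le_of_forall_le_of_nonneg (norm_nonneg _) hi).trans_lt (h i)

end Families

variable {k : Type u} [NormedField k] [IsUltrametricDist k] [CompleteSpace k] {n : ℕ}
  {lam : Fin n → k}

namespace Alg

/-- The norm of `Alg lam`, obtained from its structure of normed ring. This shortcut makes the norm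
in the lemmas below the one found by the general theory of normed rings. -/
instance normOfRing : Norm (Alg lam) := NormedRing.toNorm

theorem norm_eq_iSup (f : Alg lam) : ‖f‖ = ⨆ m, ‖f.coeff m‖ * weight lam m := rfl

theorem term_le_norm (f : Alg lam) (m : Fin n → ℤ) : ‖f.coeff m‖ * weight lam m ≤ ‖f‖ :=
  f.le_norm m

theorem norm_le_of_forall {f : Alg lam} {C : ℝ} (h : ∀ m, ‖f.coeff m‖ * weight lam m ≤ C) :
    ‖f‖ ≤ C := ciSup_le h

theorem norm_coeff_le (f : Alg lam) (m : Fin n → ℤ) : ‖f.coeff m‖ ≤ ‖f‖ :=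
  (le_mul_of_one_le_right (norm_nonneg _) (one_le_weight lam m)).trans (f.term_le_norm m)

theorem norm_lt_of_forall {f : Alg lam} {C : ℝ} (h : ∀ m, ‖f.coeff m‖ * weight lam m < C) :
    ‖f‖ < C := by
  obtain ⟨m, hm⟩ := exists_forall_le_of_tendsto_cofinite_zero
    (fun m => mul_nonneg (norm_nonneg (f.coeff m)) (weight_nonneg lam m)) f.tendsto_coeff
  exact (norm_le_of_forall hm).trans_lt (h m)

@[simp] theorem coeff_sub (f g : Alg lam) (m : Fin n → ℤ) :
    (f - g).coeff m = f.coeff m - g.coeff m := rfl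

theorem norm_smul' (a : k) (f : Alg lam) : ‖a • f‖ = ‖a‖ * ‖f‖ := by
  simp only [norm_eq_iSup, coeff_smul, norm_mul, mul_assoc]
  rw [Real.mul_iSup_of_nonneg (norm_nonneg a)]

instance : NormedAlgebra k (Alg lam) where
  norm_smul_le a f := (norm_smul' a f).le

instance : IsUltrametricDist (Alg lam) := by
  refine IsUltrametricDist.isUltrametricDist_of_forall_norm_add_le_max_norm (fun f g => ?_)
  refine norm_le_of_forall (fun m => ?_)
  refine (mul_le_mul_of_nonneg_right (IsUltrametricDist.norm_add_le_max (f.coeff m) (g.coeff m))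
    (weight_nonneg lam m)).trans ?_
  rw [max_mul_of_nonneg _ _ (weight_nonneg lam m)]
  exact max_le_max (f.term_le_norm m) (g.term_le_norm m)

/-- The coefficient of `x^m` as a continuous linear functional. -/
def coeffL (m : Fin n → ℤ) : Alg lam →L[k] k :=
  ⟨{ toFun := fun f => f.coeff m, map_add' := fun _ _ => rfl, map_smul' := fun _ _ => rfl },
    AddMonoidHomClass.continuous_of_bound
      ({ toFun := fun f => f.coeff m, map_zero' := rfl, map_add' := fun _ _ => rfl } :
        Alg lam →+ k) 1 (fun f => by rw [one_mul]; exact f.norm_coeff_le m)⟩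

@[simp] theorem coeffL_apply (m : Fin n → ℤ) (f : Alg lam) : coeffL m f = f.coeff m := rfl

instance : CompleteSpace (Alg lam) := by
  refine Metric.complete_of_cauchySeq_tendsto (fun F hF => ?_)
  have hc : ∀ m, CauchySeq (fun N => (F N).coeff m) := fun m =>
    hF.map (coeffL (lam := lam) m).uniformContinuous
  choose c hc using fun m => cauchySeq_tendsto_of_complete (hc m)
  have key : ∀ ε > 0, ∃ N, ∀ a ≥ N, ∀ m, ‖(F a).coeff m - c m‖ * weight lam m ≤ ε := by
    intro ε hε
    obtain ⟨N, hN⟩ := Metric.cauchySeq_iff.1 hF ε hε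
    refine ⟨N, fun a ha m => ?_⟩
    have ht : Tendsto (fun b => ‖(F a).coeff m - (F b).coeff m‖ * weight lam m) atTop
        (𝓝 (‖(F a).coeff m - c m‖ * weight lam m)) :=
      ((hc m).const_sub _).norm.mul_const _
    refine le_of_tendsto ht (Filter.eventually_atTop.2 ⟨N, fun b hb => ?_⟩)
    have := hN a ha b hb
    rw [dist_eq_norm] at this
    exact ((F a - F b).term_le_norm m).trans this.le
  have hmem : Tendsto (fun m => ‖c m‖ * weight lam m) cofinite (𝓝 0) := by
    rw [Metric.tendsto_nhds]
    intro ε hε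
    obtain ⟨N, hN⟩ := key (ε / 2) (half_pos hε)
    rw [Filter.eventually_cofinite]
    refine ((F N).finite_le (half_pos hε)).subset (fun m hm => ?_)
    by_contra hcon
    refine hm ?_
    have h1 : ‖(F N).coeff m‖ * weight lam m < ε / 2 := not_le.1 hcon
    have h2 := hN N le_rfl m
    have h3 : ‖c m‖ ≤ ‖(F N).coeff m‖ + ‖(F N).coeff m - c m‖ := by
      have := norm_sub_le ((F N).coeff m) ((F N).coeff m - c m)
      simpa using this
    have h4 := mul_le_mul_of_nonneg_right h3 (weight_nonneg lam m)
    rw [Real.dist_eq, sub_zero, abs_of_nonneg (mul_nonneg (norm_nonneg _) (weight_nonneg lam m))]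
    rw [add_mul] at h4
    linarith
  obtain ⟨l, hl⟩ : ∃ l : Alg lam, ∀ m, l.coeff m = c m := ⟨⟨c, hmem⟩, fun _ => rfl⟩
  refine ⟨l, Metric.tendsto_atTop.2 (fun ε hε => ?_)⟩
  obtain ⟨N, hN⟩ := key (ε / 2) (half_pos hε)
  refine ⟨N, fun a ha => ?_⟩
  rw [dist_eq_norm]
  refine (norm_le_of_forall (fun m => ?_)).trans_lt (half_lt_self hε)
  rw [coeff_sub, hl]
  exact hN a ha m

instance : NormOneClass (Alg lam) := ⟨by
  refine le_antisymm (norm_le_of_forall (fun m => ?_)) ?_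
  · by_cases h : m = 0 <;> simp [coeff_one, h, weight_zero]
  · simpa [coeff_one, weight_zero] using (1 : Alg lam).term_le_norm 0⟩

instance : Nontrivial (Alg lam) := NormOneClass.nontrivial

/-! ### Gauss seminorms -/

/-- The absolute value at radius `r` of the monomial `x^m`. -/
def radiusPow (r : Fin n → ℝ) (m : Fin n → ℤ) : ℝ := ∏ i, r i ^ m i

theorem radiusPow_pos {r : Fin n → ℝ} (hr : ∀ i, 0 < r i) (m : Fin n → ℤ) : 0 < radiusPow r m :=
  Finset.prod_pos fun i _ => zpow_pos (hr i) _

theorem radiusPow_add {r : Fin n → ℝ} (hr : ∀ i, 0 < r i) (p q : Fin n → ℤ) :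
    radiusPow r (p + q) = radiusPow r p * radiusPow r q := by
  simp only [radiusPow, ← Finset.prod_mul_distrib]
  exact Finset.prod_congr rfl fun i _ => by rw [Pi.add_apply, zpow_add₀ (hr i).ne']

@[simp] theorem radiusPow_zero (r : Fin n → ℝ) : radiusPow r 0 = 1 := by simp [radiusPow]

/-- The polyradii of the points of the skeleton: `|lam i| ≤ r i ≤ 1`. The strict positivity
required here is automatic when no `lam i` vanishes. -/
structure IsRadius (lam : Fin n → k) (r : Fin n → ℝ) : Prop where
  pos : ∀ i, 0 < r i
  le_one : ∀ i, r i ≤ 1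
  norm_le : ∀ i, ‖lam i‖ ≤ r i

variable {r : Fin n → ℝ}

theorem IsRadius.radiusPow_le_weight (hr : IsRadius lam r) (hlam : ∀ i, lam i ≠ 0)
    (m : Fin n → ℤ) : radiusPow r m ≤ weight lam m := by
  refine Finset.prod_le_prod (fun i _ => (zpow_pos (hr.pos i) _).le) (fun i _ => ?_)
  rcases le_total 0 (m i) with h | h
  · refine le_trans ?_ (le_max_left _ _)
    obtain ⟨N, hN⟩ := Int.eq_ofNat_of_zero_le h
    rw [hN, zpow_natCast]
    exact pow_le_one₀ (hr.pos i).le (hr.le_one i)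
  · refine le_trans ?_ (le_max_right _ _)
    obtain ⟨N, hN⟩ := Int.exists_eq_neg_ofNat h
    rw [hN, zpow_neg, zpow_neg, zpow_natCast, zpow_natCast]
    exact inv_anti₀ (pow_pos (norm_pos_iff.2 (hlam i)) _)
      (pow_le_pow_left₀ (norm_nonneg _) (hr.norm_le i) _)

/-- The Gauss seminorm `max |c_m| r^m` of radius `r`. -/
def gauss (r : Fin n → ℝ) (f : Alg lam) : ℝ := ⨆ m, ‖f.coeff m‖ * radiusPow r m

theorem gauss_zero : gauss r (0 : Alg lam) = 0 := by simp [gauss]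

section Gauss

variable (hr : IsRadius lam r) (hlam : ∀ i, lam i ≠ 0)

theorem term_nonneg (hr : IsRadius lam r) (f : Alg lam) (m : Fin n → ℤ) :
    0 ≤ ‖f.coeff m‖ * radiusPow r m :=
  mul_nonneg (norm_nonneg _) (radiusPow_pos hr.pos m).le

include hr hlam

theorem tendsto_term (f : Alg lam) :
    Tendsto (fun m => ‖f.coeff m‖ * radiusPow r m) cofinite (𝓝 0) :=
  squeeze_zero (term_nonneg hr f) (fun m => mul_le_mul_of_nonneg_left
    (hr.radiusPow_le_weight hlam m) (norm_nonneg _)) f.tendsto_coeff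

theorem gaussTerm_le_norm (f : Alg lam) (m : Fin n → ℤ) : ‖f.coeff m‖ * radiusPow r m ≤ ‖f‖ :=
  (mul_le_mul_of_nonneg_left (hr.radiusPow_le_weight hlam m) (norm_nonneg _)).trans (f.term_le_norm m)

theorem le_gauss (f : Alg lam) (m : Fin n → ℤ) : ‖f.coeff m‖ * radiusPow r m ≤ gauss r f :=
  le_ciSup (f := fun m => ‖f.coeff m‖ * radiusPow r m)
    ⟨‖f‖, by rintro _ ⟨p, rfl⟩; exact gaussTerm_le_norm hr hlam f p⟩ m

theorem gauss_le_norm (f : Alg lam) : gauss r f ≤ ‖f‖ := ciSup_le (gaussTerm_le_norm hr hlam f)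

theorem gauss_nonneg (f : Alg lam) : 0 ≤ gauss r f :=
  (term_nonneg hr f 0).trans (le_gauss hr hlam f 0)

theorem exists_eq_gauss (f : Alg lam) : ∃ m, ‖f.coeff m‖ * radiusPow r m = gauss r f := by
  obtain ⟨m, hm⟩ := exists_forall_le_of_tendsto_cofinite_zero (term_nonneg hr f)
    (tendsto_term hr hlam f)
  exact ⟨m, le_antisymm (le_gauss hr hlam f m) (ciSup_le hm)⟩

theorem gauss_pos {f : Alg lam} (hf : f ≠ 0) : 0 < gauss r f := by
  obtain ⟨m, hm⟩ : ∃ m, f.coeff m ≠ 0 := by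
    by_contra! h
    exact hf (Alg.ext h)
  exact (mul_pos (norm_pos_iff.2 hm) (radiusPow_pos hr.pos m)).trans_le (le_gauss hr hlam f m)

theorem gauss_add_le (f g : Alg lam) : gauss r (f + g) ≤ max (gauss r f) (gauss r g) := by
  refine ciSup_le (fun m => ?_)
  refine (mul_le_mul_of_nonneg_right (IsUltrametricDist.norm_add_le_max (f.coeff m) (g.coeff m))
    (radiusPow_pos hr.pos m).le).trans ?_
  rw [max_mul_of_nonneg _ _ (radiusPow_pos hr.pos m).le]
  exact max_le_max (le_gauss hr hlam f m) (le_gauss hr hlam g m)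

theorem gauss_one : gauss r (1 : Alg lam) = 1 := by
  refine le_antisymm (ciSup_le (fun m => ?_)) ?_
  · by_cases h : m = 0 <;> simp [coeff_one, h]
  · simpa [coeff_one] using le_gauss hr hlam (1 : Alg lam) 0

theorem gauss_mul_le (f g : Alg lam) : gauss r (f * g) ≤ gauss r f * gauss r g := by
  refine ciSup_le (fun m => ?_)
  rw [coeff_mul, ← le_div_iff₀ (radiusPow_pos hr.pos m)]
  have h0 := mul_nonneg (gauss_nonneg hr hlam f) (gauss_nonneg hr hlam g)
  refine IsUltrametricDist.norm_tsum_le_of_forall_le_of_nonneg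
    (div_nonneg h0 (radiusPow_pos hr.pos m).le) (fun p => ?_)
  rw [le_div_iff₀ (radiusPow_pos hr.pos m), norm_mul]
  calc ‖f.coeff p‖ * ‖g.coeff (m - p)‖ * radiusPow r m
      = (‖f.coeff p‖ * radiusPow r p) * (‖g.coeff (m - p)‖ * radiusPow r (m - p)) := by
        rw [← add_sub_cancel p m, radiusPow_add hr.pos]
        simp only [add_sub_cancel]
        ring
    _ ≤ _ := mul_le_mul (le_gauss hr hlam f p) (le_gauss hr hlam g _) (term_nonneg hr g _)
        (gauss_nonneg hr hlam f)

/-- The exponents whose terms attain the Gauss norm of a nonzero `f`. -/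
def dominant (r : Fin n → ℝ) (f : Alg lam) : Set (Fin n → ℤ) :=
  {m | ‖f.coeff m‖ * radiusPow r m = gauss r f}

omit hr hlam in
theorem mem_dominant {f : Alg lam} {m : Fin n → ℤ} :
    m ∈ dominant r f ↔ ‖f.coeff m‖ * radiusPow r m = gauss r f := Iff.rfl

theorem dominant_finite {f : Alg lam} (hf : f ≠ 0) : (dominant r f).Finite := by
  have h := (tendsto_term hr hlam f).eventually (gt_mem_nhds (gauss_pos hr hlam hf))
  refine Set.Finite.subset (Filter.eventually_cofinite.1 h) (fun m hm => ?_)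
  exact not_lt.2 (mem_dominant.1 hm).ge

theorem dominant_nonempty (f : Alg lam) : (dominant r f).Nonempty := exists_eq_gauss hr hlam f

/-- If the exponent `p + q` arises in only one way as a sum of dominant exponents of `f` and of
`g`, then no cancellation can happen in the corresponding coefficient of `f * g`. -/
theorem norm_coeff_mul_of_uniqueAdd {f g : Alg lam} (hf : f ≠ 0) (hg : g ≠ 0)
    {p q : Fin n → ℤ} (hp : p ∈ dominant r f) (hq : q ∈ dominant r g)
    (hu : ∀ p' ∈ dominant r f, ∀ q' ∈ dominant r g, p' + q' = p + q → p' = p) :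
    ‖(f * g).coeff (p + q)‖ * radiusPow r (p + q) = gauss r f * gauss r g := by
  classical
  set C := gauss r f * gauss r g / radiusPow r (p + q) with hC
  have hR := radiusPow_pos hr.pos (p + q)
  have hCpos : 0 < C := div_pos (mul_pos (gauss_pos hr hlam hf) (gauss_pos hr hlam hg)) hR
  have hsplit : ∀ s, ‖f.coeff s * g.coeff (p + q - s)‖ * radiusPow r (p + q) =
      (‖f.coeff s‖ * radiusPow r s) * (‖g.coeff (p + q - s)‖ * radiusPow r (p + q - s)) := by
    intro s
    have : radiusPow r (p + q) = radiusPow r s * radiusPow r (p + q - s) := by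
      rw [← radiusPow_add hr.pos, add_sub_cancel]
    rw [this, norm_mul]
    ring
  have hmain : ‖f.coeff p * g.coeff (p + q - p)‖ = C := by
    rw [hC, eq_div_iff hR.ne', hsplit, add_sub_cancel_left, mem_dominant.1 hp, mem_dominant.1 hq]
  have hother : ∀ s, s ≠ p → ‖f.coeff s * g.coeff (p + q - s)‖ < C := by
    intro s hs
    rw [hC, lt_div_iff₀ hR, hsplit]
    refine lt_of_le_of_ne (mul_le_mul (le_gauss hr hlam f s) (le_gauss hr hlam g _)
      (term_nonneg hr g _) (gauss_nonneg hr hlam f)) (fun h => ?_)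
    have h1 := le_gauss hr hlam f s
    have h2 := le_gauss hr hlam g (p + q - s)
    have hf0 := gauss_pos hr hlam hf
    have hg0 := gauss_pos hr hlam hg
    have e1 : ‖f.coeff s‖ * radiusPow r s = gauss r f := by
      by_contra hne
      exact (mul_lt_mul_of_lt_of_le_of_nonneg_of_pos (lt_of_le_of_ne h1 hne) h2
        (term_nonneg hr f s) hg0).ne h
    have e2 : ‖g.coeff (p + q - s)‖ * radiusPow r (p + q - s) = gauss r g := by
      rw [e1] at h
      exact mul_left_cancel₀ hf0.ne' h
    exact hs (hu s e1 (p + q - s) e2 (add_sub_cancel _ _))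
  have hsum := summable_conv f g (p + q)
  have htail : ‖∑' s, ite (s = p) 0 (f.coeff s * g.coeff (p + q - s))‖ < C := by
    refine norm_tsum_lt ?_ hCpos (fun s => ?_)
    · refine squeeze_zero_norm (a := fun s => ‖f.coeff s * g.coeff (p + q - s)‖) (fun s => ?_)
        (tendsto_zero_iff_norm_tendsto_zero.1 hsum.tendsto_cofinite_zero)
      split_ifs
      · simpa using norm_nonneg (f.coeff s * g.coeff (p + q - s))
      · exact le_rfl
    · split_ifs with hs
      · simpa using hCpos
      · exact hother s hs
  rw [coeff_mul, hsum.tsum_eq_add_tsum_ite p, ← eq_div_iff hR.ne', ← hC,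
    IsUltrametricDist.norm_add_eq_max_of_norm_ne_norm (by rw [hmain]; exact htail.ne'), hmain,
    max_eq_left htail.le]

theorem gauss_mul (f g : Alg lam) : gauss r (f * g) = gauss r f * gauss r g := by
  by_cases hf : f = 0
  · simp [hf, gauss_zero]
  by_cases hg : g = 0
  · simp [hg, gauss_zero]
  refine le_antisymm (gauss_mul_le hr hlam f g) ?_
  have hF := dominant_finite hr hlam hf
  have hG := dominant_finite hr hlam hg
  obtain ⟨p, hp, q, hq, hu⟩ := UniqueSums.uniqueAdd_of_nonempty
    (A := hF.toFinset) (B := hG.toFinset)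
    (by simpa using dominant_nonempty hr hlam f) (by simpa using dominant_nonempty hr hlam g)
  rw [Set.Finite.mem_toFinset] at hp hq
  rw [← norm_coeff_mul_of_uniqueAdd hr hlam hf hg hp hq (fun p' hp' q' hq' h =>
    (hu (hF.mem_toFinset.2 hp') (hG.mem_toFinset.2 hq') h).1)]
  exact le_gauss hr hlam _ _

/-- At each radius, a unit has a single dominant term: the initial forms of `f` and `f⁻¹` are
Laurent polynomials whose product is `1`. -/
theorem dominant_subsingleton {f g : Alg lam} (hfg : f * g = 1) :
    (dominant r f).Subsingleton := by
  have hf : f ≠ 0 := by rintro rfl; simp at hfg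
  have hg : g ≠ 0 := by rintro rfl; simp at hfg
  have hF := dominant_finite hr hlam hf
  have hG := dominant_finite hr hlam hg
  intro a ha b hb
  by_contra hab
  obtain ⟨c, hc⟩ := dominant_nonempty hr hlam g
  have hcard : 1 < hF.toFinset.card * hG.toFinset.card := by
    have h1 : 1 < hF.toFinset.card :=
      Finset.one_lt_card.2 ⟨a, hF.mem_toFinset.2 ha, b, hF.mem_toFinset.2 hb, hab⟩
    have h2 : 0 < hG.toFinset.card := Finset.card_pos.2 ⟨c, hG.mem_toFinset.2 hc⟩
    nlinarith
  obtain ⟨s, hs, t, ht, hst, hus, hut⟩ := TwoUniqueSums.uniqueAdd_of_one_lt_card hcard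
  rw [Finset.mem_product, Set.Finite.mem_toFinset, Set.Finite.mem_toFinset] at hs ht
  have key : ∀ s : (Fin n → ℤ) × (Fin n → ℤ), s.1 ∈ dominant r f → s.2 ∈ dominant r g →
      UniqueAdd hF.toFinset hG.toFinset s.1 s.2 → s.1 + s.2 = 0 := by
    intro s hs1 hs2 hu
    have h := norm_coeff_mul_of_uniqueAdd hr hlam hf hg hs1 hs2 (fun p' hp' q' hq' h =>
      (hu (hF.mem_toFinset.2 hp') (hG.mem_toFinset.2 hq') h).1)
    by_contra hne
    rw [hfg, coeff_one, if_neg hne] at h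
    have h3 := mul_pos (gauss_pos hr hlam hf) (gauss_pos hr hlam hg)
    rw [norm_zero, zero_mul] at h
    exact h3.ne h
  have e := (key s hs.1 hs.2 hus).trans (key t ht.1 ht.2 hut).symm
  obtain ⟨h1, h2⟩ := hut (hF.mem_toFinset.2 hs.1) (hG.mem_toFinset.2 hs.2) e
  exact hst (Prod.ext h1 h2)

end Gauss

/-- The point of the skeleton of polyradius `r`. -/
def gaussPoint (hr : IsRadius lam r) (hlam : ∀ i, lam i ≠ 0) : Point lam where
  val :=
    { toFun := fun f => ⟨gauss r f, gauss_nonneg hr hlam f⟩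
      map_zero' := NNReal.eq (gauss_zero)
      map_one' := NNReal.eq (gauss_one hr hlam)
      map_mul' := fun f g => NNReal.eq (gauss_mul hr hlam f g)
      map_add_le_max' := fun f g => gauss_add_le hr hlam f g }
  bounded := ⟨1, fun f => by rw [one_mul]; exact gauss_le_norm hr hlam f⟩

theorem gaussPoint_val (hr : IsRadius lam r) (hlam : ∀ i, lam i ≠ 0) (f : Alg lam) :
    ((gaussPoint hr hlam).val f : ℝ) = gauss r f := rfl

theorem gaussPoint_mem_skeleton (hr : IsRadius lam r) (hlam : ∀ i, lam i ≠ 0) :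
    gaussPoint hr hlam ∈ skeleton lam :=
  ⟨r, fun i => ⟨hr.norm_le i, hr.le_one i⟩, fun _ => rfl⟩

end Alg

/-! ### The Kähler seminorm on the skeleton -/

namespace Alg

theorem theta_X (i j : Fin n) : theta j (X lam i) = if j = i then X lam i else 0 := by
  ext m
  rw [coeff_theta, X, coeff_monomial]
  by_cases hm : m = Pi.single i 1
  · subst hm
    by_cases hj : j = i
    · subst hj; simp [coeff_monomial]
    · simp [hj]
  · by_cases hj : j = i
    · simp [hj, hm, coeff_monomial]
    · simp [hj, hm]

theorem d_apply (f : Alg lam) (i : Fin n) : d lam f i = theta i f := rfl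

/-- `x_i ∂/∂x_i` as a derivation. -/
def thetaDer (lam : Fin n → k) (i : Fin n) : Derivation k (Alg lam) (Alg lam) :=
  (LinearMap.proj i).compDer (d lam)

@[simp] theorem thetaDer_apply (i : Fin n) (f : Alg lam) : thetaDer lam i f = theta i f := rfl

theorem gauss_theta_le {r : Fin n → ℝ} (hr : IsRadius lam r) (hlam : ∀ i, lam i ≠ 0) (i : Fin n)
    (f : Alg lam) : gauss r (theta i f) ≤ gauss r f := by
  refine ciSup_le (fun m => le_trans ?_ (le_gauss hr hlam f m))
  refine mul_le_mul_of_nonneg_right ?_ (radiusPow_pos hr.pos m).le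
  rw [coeff_theta, norm_mul]
  exact mul_le_of_le_one_left (norm_nonneg _) (IsUltrametricDist.norm_intCast_le_one k (m i))

end Alg

namespace Point

theorem evalForm_eq (y : Point lam) (ω : TopForm lam) :
    y.evalForm ω = (y.eval (formCoeff lam ω) * ∏ i, y.eval (Alg.Xinv lam i)) •
      exteriorPower.ιMulti y.ResField n
        (fun i => KaehlerDifferential.D k y.ResField (y.eval (Alg.X lam i))) := by
  rw [evalForm, AlternatingMap.map_smul_univ, smul_smul]

theorem val_X_mul_Xinv (y : Point lam) (i : Fin n) :
    y.val (Alg.X lam i) * y.val (Alg.Xinv lam i) = 1 := by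
  rw [← map_mul, Alg.X_mul_Xinv, map_one]

theorem formNorm_le (y : Point lam) (ω : TopForm lam) :
    y.formNorm ω ≤ y.val (formCoeff lam ω) := by
  refine csInf_le (OrderBot.bddBelow _) ⟨1, fun _ => y.eval (formCoeff lam ω) *
    ∏ i, y.eval (Alg.Xinv lam i), fun _ i => y.eval (Alg.X lam i), ?_, fun _ => ?_⟩
  · rw [evalForm_eq]; simp
  · rw [map_mul, map_prod]
    simp only [resVal_eval]
    rw [mul_assoc, ← Finset.prod_mul_distrib]
    refine le_of_eq ?_
    rw [Finset.prod_eq_one (fun i _ => by rw [mul_comm]; exact y.val_X_mul_Xinv i), mul_one]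

theorem exists_eval_mul_eq (y : Point lam) (z : y.ResField) :
    ∃ a b : Alg lam, y.eval b ≠ 0 ∧ z * y.eval b = y.eval a := by
  obtain ⟨⟨a, b⟩, h⟩ := IsLocalization.surj (nonZeroDivisors (Alg lam ⧸ y.val.supp)) z
  obtain ⟨a', ha'⟩ := Ideal.Quotient.mk_surjective a
  obtain ⟨b', hb'⟩ := Ideal.Quotient.mk_surjective (b : Alg lam ⧸ y.val.supp)
  refine ⟨a', b', ?_, ?_⟩
  · have : y.eval b' = algebraMap _ y.ResField (b : Alg lam ⧸ y.val.supp) := by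
      rw [← hb']; rfl
    rw [this]
    exact (IsLocalization.map_units y.ResField b).ne_zero
  · rw [← ha', ← hb'] at h
    exact h

/-- If the derivations `x_i ∂/∂x_i` do not increase absolute values at `y`, and no nonzero function
vanishes at `y`, then `‖dx/x‖ = 1` at `y`. -/
theorem formNorm_eq (y : Point lam) (h0 : ∀ f, y.val f = 0 → f = 0)
    (hθ : ∀ i f, y.val (Alg.theta i f) ≤ y.val f) (ω : TopForm lam) :
    y.formNorm ω = y.val (formCoeff lam ω) := by
  refine le_antisymm (y.formNorm_le ω) ?_
  have hinj : Function.Injective y.eval := by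
    rw [injective_iff_map_eq_zero]
    intro f hf
    exact h0 f (by rw [← resVal_eval, hf, map_zero])
  choose D hD using fun i => exists_derivation_extension y.eval hinj y.exists_eval_mul_eq
    (Alg.thetaDer lam i)
  have hDle : ∀ l b, y.resVal (D l b) ≤ y.resVal b := by
    intro l z
    obtain ⟨a, b, hb, h⟩ := y.exists_eval_mul_eq z
    have hvb : 0 < y.resVal (y.eval b) := (Valuation.pos_iff _).2 hb
    have h1 := congrArg (D l) h
    rw [Derivation.leibniz, hD, hD, smul_eq_mul, smul_eq_mul, ← eq_sub_iff_add_eq'] at h1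
    have hv := congrArg y.resVal h
    rw [map_mul] at hv
    refine le_of_mul_le_mul_left ?_ hvb
    rw [← map_mul, h1]
    refine (Valuation.map_sub _ _ _).trans (max_le ?_ ?_)
    · rw [mul_comm, hv, resVal_eval, resVal_eval]
      exact hθ l a
    · rw [map_mul, mul_comm]
      gcongr
      rw [resVal_eval, resVal_eval]
      exact hθ l b
  have hexp := y.evalForm_eq ω
  have hc : contraction D (y.evalForm ω) = y.eval (formCoeff lam ω) := by
    rw [evalForm, map_smul, contraction_ιMulti, smul_eq_mul]
    rw [show (Matrix.of fun i l => (D l).liftKaehlerDifferential (y.eval (Alg.Xinv lam i) •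
      KaehlerDifferential.D k y.ResField (y.eval (Alg.X lam i)))) = 1 from ?_, Matrix.det_one,
      mul_one]
    ext i l
    rw [Matrix.of_apply, map_smul, Derivation.liftKaehlerDifferential_comp_D, hD,
      Alg.thetaDer_apply, Alg.theta_X, smul_eq_mul, ← map_mul, Matrix.one_apply]
    by_cases h : l = i
    · rw [if_pos h, if_pos h.symm, mul_comm, Alg.X_mul_Xinv, map_one]
    · rw [if_neg h, if_neg (Ne.symm h), mul_zero, map_zero]
  rw [← resVal_eval, ← hc]
  exact le_kahlerSeminorm y.resVal D hDle _ ⟨1, fun _ => y.eval (formCoeff lam ω) *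
    ∏ i, y.eval (Alg.Xinv lam i), fun _ i => y.eval (Alg.X lam i), by rw [hexp]; simp⟩

theorem gaussPoint_formNorm {r : Fin n → ℝ} (hr : Alg.IsRadius lam r) (hlam : ∀ i, lam i ≠ 0)
    (ω : TopForm lam) :
    ((Alg.gaussPoint hr hlam).formNorm ω : ℝ) = Alg.gauss r (formCoeff lam ω) := by
  rw [formNorm_eq, Alg.gaussPoint_val]
  · intro f hf
    by_contra hne
    have h := Alg.gauss_pos hr hlam hne
    rw [← Alg.gaussPoint_val hr hlam, hf] at h
    exact lt_irrefl _ h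
  · exact fun i f => Alg.gauss_theta_le hr hlam i f

/-- Bounded multiplicative seminorms are bounded by the norm, with constant `1`. -/
theorem val_le_norm (y : Point lam) (f : Alg lam) : (y.val f : ℝ) ≤ ‖f‖ := by
  obtain ⟨C, hC⟩ : ∃ C : ℝ, ∀ f, (y.val f : ℝ) ≤ C * ‖f‖ := y.bounded
  by_contra! hlt
  have hv : 0 < (y.val f : ℝ) := (norm_nonneg f).trans_lt hlt
  have hpow : ∀ N : ℕ, (1 : ℝ) ≤ C * (‖f‖ / y.val f) ^ N := by
    intro N
    have h1 := hC (f ^ N)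
    rw [map_pow, NNReal.coe_pow] at h1
    have hC0 : 0 ≤ C := by
      have := (hC 1)
      rw [map_one, norm_one, mul_one] at this
      exact zero_le_one.trans (by exact_mod_cast this)
    have h2 := h1.trans (mul_le_mul_of_nonneg_left (norm_pow_le f N) hC0)
    rw [div_pow, ← mul_div_assoc, le_div_iff₀ (pow_pos hv N), one_mul]
    exact h2
  have hlim : Tendsto (fun N : ℕ => C * (‖f‖ / y.val f) ^ N) atTop (𝓝 (C * 0)) :=
    (tendsto_pow_atTop_nhds_zero_of_lt_one (div_nonneg (norm_nonneg _) hv.le)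
      ((div_lt_one hv).2 hlt)).const_mul C
  have := ge_of_tendsto' hlim hpow
  rw [mul_zero] at this
  exact absurd this (by norm_num)

theorem val_one_add (y : Point lam) {h : Alg lam} (hh : ‖h‖ < 1) : y.val (1 + h) = 1 := by
  refine y.val.map_one_add_of_lt ?_
  rw [← NNReal.coe_lt_coe]
  exact (y.val_le_norm h).trans_lt hh

end Point

theorem supNorm_lt_one {h : Alg lam} (hh : ‖h‖ < 1) : supNorm h < 1 := by
  refine (ciSup_le' (a := ⟨‖h‖, norm_nonneg h⟩) (fun y => ?_)).trans_lt ?_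
  · exact y.val_le_norm h
  · exact hh

/-! ### Volume forms with constant norm on the skeleton -/

namespace Alg

theorem coeff_algebraMap (c : k) (m : Fin n → ℤ) :
    (algebraMap k (Alg lam) c).coeff m = if m = 0 then c else 0 := by
  rw [Algebra.algebraMap_eq_smul_one, coeff_smul, coeff_one]
  split_ifs <;> simp

/-- The vertex of the polyradius box at which `x^m` is largest. -/
def vertex (lam : Fin n → k) (m : Fin n → ℤ) (i : Fin n) : ℝ := if 0 ≤ m i then 1 else ‖lam i‖

section

variable (hlam : ∀ i, lam i ≠ 0 ∧ ‖lam i‖ < 1)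
include hlam

theorem isRadius_vertex (m : Fin n → ℤ) : IsRadius lam (vertex lam m) where
  pos i := by unfold vertex; split_ifs; exacts [one_pos, norm_pos_iff.2 (hlam i).1]
  le_one i := by unfold vertex; split_ifs; exacts [le_rfl, (hlam i).2.le]
  norm_le i := by unfold vertex; split_ifs; exacts [(hlam i).2.le, le_rfl]

theorem radiusPow_vertex (m : Fin n → ℤ) : radiusPow (vertex lam m) m = weight lam m := by
  refine Finset.prod_congr rfl (fun i _ => ?_)
  have hpos := norm_pos_iff.2 (hlam i).1
  unfold vertex
  split_ifs with h
  · rw [one_zpow, max_eq_left]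
    obtain ⟨N, hN⟩ := Int.eq_ofNat_of_zero_le h
    rw [hN, zpow_natCast]
    exact pow_le_one₀ hpos.le (hlam i).2.le
  · rw [max_eq_right]
    obtain ⟨N, hN⟩ := Int.exists_eq_neg_ofNat (not_le.1 h).le
    rw [hN, zpow_neg, zpow_natCast]
    exact (one_le_inv₀ (pow_pos hpos N)).2 (pow_le_one₀ hpos.le (hlam i).2.le)

theorem one_lt_weight_mul_weight_neg {m : Fin n → ℤ} (hm : m ≠ 0) :
    1 < weight lam m * weight lam (-m) := by
  obtain ⟨i, hi⟩ := Function.ne_iff.1 hm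
  rw [Pi.zero_apply] at hi
  unfold weight
  rw [← Finset.prod_mul_distrib]
  calc (1 : ℝ) = ∏ _i : Fin n, (1 : ℝ) := by simp
    _ < _ := ?_
  have h1 : ∀ j, (1 : ℝ) ≤ max 1 (‖lam j‖ ^ m j) := fun j => le_max_left _ _
  have h2 : ∀ j, (1 : ℝ) ≤ max 1 (‖lam j‖ ^ (-m) j) := fun j => le_max_left _ _
  refine Finset.prod_lt_prod (fun _ _ => one_pos)
    (fun j _ => one_le_mul_of_one_le_of_one_le (h1 j) (h2 j)) ⟨i, Finset.mem_univ i, ?_⟩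
  have hpos := norm_pos_iff.2 (hlam i).1
  rcases lt_or_gt_of_ne hi with h | h
  · exact one_lt_mul_of_lt_of_le ((one_lt_zpow_of_neg₀ hpos (hlam i).2 h).trans_le
      (le_max_right _ _)) (h2 i)
  · refine one_lt_mul_of_le_of_lt (h1 i) ?_
    exact (one_lt_zpow_of_neg₀ hpos (hlam i).2 (by simpa using h)).trans_le (le_max_right _ _)

/-- A unit whose Gauss norms do not depend on the radius is dominated by its constant term: the
dominant exponent `p` of `f` satisfies `weight p * weight (-p) ≤ 1`, which forces `p = 0`, and at
each vertex there is no other dominant exponent. -/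
theorem norm_sub_coeff_zero_lt {f g : Alg lam} (hfg : f * g = 1) {C : ℝ}
    (hC : ∀ r, IsRadius lam r → gauss r f = C) :
    ‖f - algebraMap k (Alg lam) (f.coeff 0)‖ < ‖f.coeff 0‖ := by
  have hlam0 : ∀ i, lam i ≠ 0 := fun i => (hlam i).1
  have hV := fun m => isRadius_vertex hlam (m : Fin n → ℤ)
  have hf : f ≠ 0 := by rintro rfl; simp at hfg
  have hCpos : 0 < C := by rw [← hC _ (hV 0)]; exact gauss_pos (hV 0) hlam0 hf
  have hCg : ∀ r, IsRadius lam r → gauss r g = C⁻¹ := by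
    intro r hr
    refine eq_inv_of_mul_eq_one_right ?_
    rw [← hC r hr, ← gauss_mul hr hlam0, hfg,
      gauss_one hr hlam0]
  have hfC : ∀ m, ‖f.coeff m‖ * weight lam m ≤ C := fun m => by
    rw [← radiusPow_vertex hlam, ← hC _ (hV m)]
    exact le_gauss (hV m) hlam0 f m
  have hgC : ∀ m, ‖g.coeff m‖ * weight lam m ≤ C⁻¹ := fun m => by
    rw [← radiusPow_vertex hlam, ← hCg _ (hV m)]
    exact le_gauss (hV m) hlam0 g m
  have h0 : ‖f.coeff 0‖ = C := by
    obtain ⟨p, hp⟩ : ∃ p, 1 ≤ ‖f.coeff p * g.coeff (0 - p)‖ := by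
      by_contra! hlt
      have h1 := norm_tsum_lt (summable_conv f g 0).tendsto_cofinite_zero one_pos hlt
      rw [← coeff_mul, hfg, coeff_one, if_pos rfl, norm_one] at h1
      exact lt_irrefl _ h1
    rw [zero_sub, norm_mul] at hp
    have hprod := mul_le_mul (hfC p) (hgC (-p))
      (mul_nonneg (norm_nonneg _) (weight_nonneg lam _)) hCpos.le
    rw [mul_inv_cancel₀ hCpos.ne'] at hprod
    have hpz : p = 0 := by
      by_contra hne
      have hw := one_lt_weight_mul_weight_neg hlam hne
      have : 1 < (‖f.coeff p‖ * ‖g.coeff (-p)‖) * (weight lam p * weight lam (-p)) :=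
        one_lt_mul_of_le_of_lt hp hw
      linarith [this, hprod]
    subst hpz
    have hf0 := hfC 0
    have hg0 := hgC 0
    rw [weight_zero, mul_one] at hf0 hg0
    refine le_antisymm hf0 ?_
    rw [neg_zero] at hp
    have := hp.trans (mul_le_mul_of_nonneg_left hg0 (norm_nonneg _))
    rwa [← div_eq_mul_inv, le_div_iff₀ hCpos, one_mul] at this
  refine norm_lt_of_forall (fun m => ?_)
  rw [coeff_sub, coeff_algebraMap]
  by_cases hm : m = 0
  · subst hm
    rw [if_pos rfl, sub_self, norm_zero, zero_mul, h0]
    exact hCpos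
  rw [if_neg hm, sub_zero, h0]
  refine lt_of_le_of_ne (hfC m) (fun h => hm ?_)
  refine dominant_subsingleton (hV m) hlam0 hfg ?_ ?_
  · rw [mem_dominant, radiusPow_vertex hlam, h, hC _ (hV m)]
  · rw [mem_dominant, radiusPow_zero, mul_one, h0, hC _ (hV m)]

end

end Alg

theorem isUnit_of_isVolumeForm {f : Alg lam} (h : IsVolumeForm (f • stdForm lam)) :
    ∃ g, f * g = 1 := by
  have h1 : stdForm lam ∈ Submodule.span (Alg lam) {f • stdForm lam} := by
    rw [show Submodule.span (Alg lam) {f • stdForm lam} = ⊤ from h]; trivial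
  obtain ⟨g, hg⟩ := Submodule.mem_span_singleton.1 h1
  refine ⟨g, ?_⟩
  have := congrArg (formCoeff lam) hg
  rwa [map_smul, map_smul, formCoeff_stdForm, smul_eq_mul, smul_eq_mul, mul_one, mul_comm] at this

theorem gauss_eq_of_formSkeleton {f : Alg lam} (hlam : ∀ i, lam i ≠ 0)
    (h : formSkeleton (f • stdForm lam) = skeleton lam) {r s : Fin n → ℝ}
    (hr : Alg.IsRadius lam r) (hs : Alg.IsRadius lam s) : Alg.gauss r f = Alg.gauss s f := by
  have key : ∀ {r s : Fin n → ℝ}, Alg.IsRadius lam r → Alg.IsRadius lam s →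
      Alg.gauss r f ≤ Alg.gauss s f := by
    intro r s hr hs
    have hmem : Alg.gaussPoint hs hlam ∈ formSkeleton (f • stdForm lam) := by
      rw [h]; exact Alg.gaussPoint_mem_skeleton hs hlam
    have := NNReal.coe_le_coe.2 (hmem (Alg.gaussPoint hr hlam))
    rw [Point.gaussPoint_formNorm, Point.gaussPoint_formNorm] at this
    simpa [formCoeff_stdForm] using this
  exact le_antisymm (key hr hs) (key hs hr)

namespace Alg

/-! ### Series in the last variables -/

theorem exists_ne_zero_or_of_add {j : ℕ} {m p : Fin n → ℤ} (h : ∃ l : Fin n, (l : ℕ) < j ∧ m l ≠ 0) :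
    (∃ l : Fin n, (l : ℕ) < j ∧ p l ≠ 0) ∨ ∃ l : Fin n, (l : ℕ) < j ∧ (m - p) l ≠ 0 := by
  obtain ⟨l, hl, hm⟩ := h
  by_cases hp : p l = 0
  · exact Or.inr ⟨l, hl, by simpa [hp] using hm⟩
  · exact Or.inl ⟨l, hl, hp⟩

/-- The closed subalgebra of Laurent series in which the first `j` variables do not occur. -/
def tailSubalgebra (lam : Fin n → k) (j : ℕ) : Subalgebra k (Alg lam) where
  carrier := {f | ∀ m, (∃ l : Fin n, (l : ℕ) < j ∧ m l ≠ 0) → f.coeff m = 0}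
  mul_mem' := by
    intro f g hf hg m hm
    rw [coeff_mul]
    refine (tsum_congr fun p => ?_).trans tsum_zero
    rcases exists_ne_zero_or_of_add (p := p) hm with h | h
    · rw [hf p h, zero_mul]
    · rw [hg _ h, mul_zero]
  add_mem' := by
    intro f g hf hg m hm
    rw [coeff_add, hf m hm, hg m hm, add_zero]
  algebraMap_mem' := by
    rintro c m ⟨l, -, hl⟩
    rw [coeff_algebraMap, if_neg]
    rintro rfl
    exact hl rfl

theorem mem_tailSubalgebra {j : ℕ} {f : Alg lam} : f ∈ tailSubalgebra lam j ↔
    ∀ m, (∃ l : Fin n, (l : ℕ) < j ∧ m l ≠ 0) → f.coeff m = 0 := Iff.rfl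

theorem tailSubalgebra_anti {i j : ℕ} (hij : i ≤ j) :
    tailSubalgebra lam j ≤ tailSubalgebra lam i :=
  fun _ hf m ⟨l, hl, hm⟩ => hf m ⟨l, hl.trans_le hij, hm⟩

theorem isClosed_tailSubalgebra (j : ℕ) : IsClosed (tailSubalgebra lam j : Set (Alg lam)) := by
  have : (tailSubalgebra lam j : Set (Alg lam)) =
      ⋂ m, ⋂ (_ : ∃ l : Fin n, (l : ℕ) < j ∧ m l ≠ 0), coeffL m ⁻¹' {0} := by
    ext f
    simp only [SetLike.mem_coe, mem_tailSubalgebra, Set.mem_iInter, Set.mem_preimage,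
      coeffL_apply, Set.mem_singleton_iff]
  rw [this]
  exact isClosed_iInter fun m => isClosed_iInter fun _ =>
    isClosed_singleton.preimage (coeffL m).continuous

/-- The Laurent series with coefficients `s m * c m`, for a bounded family of multipliers `s`. -/
def scaleCoeff (s : (Fin n → ℤ) → k) (hs : ∀ m, ‖s m‖ ≤ 1) (f : Alg lam) : Alg lam :=
  ⟨fun m => s m * f.coeff m, by
    refine squeeze_zero (fun m => mul_nonneg (norm_nonneg _) (weight_nonneg lam m)) (fun m => ?_)
      f.tendsto_coeff
    refine mul_le_mul_of_nonneg_right ?_ (weight_nonneg lam m)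
    rw [norm_mul]
    exact mul_le_of_le_one_left (norm_nonneg _) (hs m)⟩

theorem coeff_scaleCoeff (s : (Fin n → ℤ) → k) (hs : ∀ m, ‖s m‖ ≤ 1) (f : Alg lam)
    (m : Fin n → ℤ) : (scaleCoeff s hs f).coeff m = s m * f.coeff m := rfl

theorem norm_scaleCoeff_le (s : (Fin n → ℤ) → k) (hs : ∀ m, ‖s m‖ ≤ 1) (f : Alg lam) :
    ‖scaleCoeff s hs f‖ ≤ ‖f‖ := by
  refine norm_le_of_forall (fun m => le_trans ?_ (f.term_le_norm m))
  rw [coeff_scaleCoeff, norm_mul]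
  exact mul_le_mul_of_nonneg_right (mul_le_of_le_one_left (norm_nonneg _) (hs m))
    (weight_nonneg lam m)

open Classical in
/-- The part of a Laurent series consisting of its terms without the first `j` variables. -/
def tailPart (j : ℕ) (f : Alg lam) : Alg lam :=
  scaleCoeff (fun m => if ∃ l : Fin n, (l : ℕ) < j ∧ m l ≠ 0 then 0 else 1)
    (fun m => by split_ifs <;> simp) f

open Classical in
theorem coeff_tailPart (j : ℕ) (f : Alg lam) (m : Fin n → ℤ) : (tailPart j f).coeff m =
    if ∃ l : Fin n, (l : ℕ) < j ∧ m l ≠ 0 then 0 else f.coeff m := by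
  rw [tailPart, coeff_scaleCoeff]
  split_ifs <;> simp

theorem norm_tailPart_le (j : ℕ) (f : Alg lam) : ‖tailPart j f‖ ≤ ‖f‖ := norm_scaleCoeff_le _ _ f

theorem tailPart_mem (j : ℕ) (f : Alg lam) : tailPart j f ∈ tailSubalgebra lam j := fun m hm => by
  rw [coeff_tailPart, if_pos hm]

theorem tailPart_zero (f : Alg lam) : tailPart 0 f = f := by
  ext m
  rw [coeff_tailPart, if_neg (by simp)]

theorem tailPart_eq_zero {f : Alg lam} (hf : f.coeff 0 = 0) : tailPart n f = 0 := by
  ext m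
  rw [coeff_tailPart]
  split_ifs with h
  · rfl
  · have : m = 0 := by
      funext l
      by_contra hl
      exact h ⟨l, l.2, hl⟩
    rw [this, hf, coeff_zero]

theorem norm_sub_le_max (f g : Alg lam) : ‖f - g‖ ≤ max ‖f‖ ‖g‖ := by
  rw [sub_eq_add_neg, ← norm_neg g]
  exact IsUltrametricDist.norm_add_le_max f (-g)

/-- A Laurent series close to `1` is inverted within any closed subalgebra containing it. -/
theorem exists_inverse_mem {S : Subalgebra k (Alg lam)} (hS : IsClosed (S : Set (Alg lam)))
    {a : Alg lam} (haS : a ∈ S) (ha : ‖a‖ < 1) : ∃ b ∈ S, (1 + a) * b = 1 ∧ ‖b‖ ≤ 1 := by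
  have : CompleteSpace S := hS.completeSpace_coe
  have hu : IsUnit (1 - (-⟨a, haS⟩ : S)) := by
    refine isUnit_one_sub_of_norm_lt_one ?_
    rw [norm_neg]
    exact ha
  obtain ⟨b, hb⟩ := hu.exists_right_inv
  have hb' : (1 + a) * (b : Alg lam) = 1 := by
    have := congrArg (Subtype.val) hb
    rwa [sub_neg_eq_add] at this
  refine ⟨b, b.2, hb', ?_⟩
  by_contra! hlt
  have e : (b : Alg lam) = 1 - a * b := by rw [← hb']; ring
  have h1 : ‖a * (b : Alg lam)‖ < ‖(b : Alg lam)‖ :=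
    (norm_mul_le _ _).trans_lt (mul_lt_of_lt_one_left (zero_lt_one.trans hlt) ha)
  have h2 : ‖(b : Alg lam)‖ ≤ max ‖(1 : Alg lam)‖ ‖a * (b : Alg lam)‖ := by
    conv_lhs => rw [e]
    exact norm_sub_le_max _ _
  rw [norm_one] at h2
  exact absurd h2 (not_le.2 (max_lt hlt h1))

/-! ### Exponentials and logarithmic primitives -/

theorem norm_theta_le (i : Fin n) (f : Alg lam) : ‖theta i f‖ ≤ ‖f‖ :=
  norm_scaleCoeff_le (fun m => (m i : k)) (fun m => IsUltrametricDist.norm_intCast_le_one k (m i)) f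

theorem continuous_theta (i : Fin n) : Continuous (theta i : Alg lam → Alg lam) :=
  AddMonoidHomClass.continuous_of_bound (theta i : Alg lam →ₗ[k] Alg lam) 1
    (fun f => by rw [one_mul]; exact norm_theta_le i f)

/-- Each `w` with `‖w‖ < 1` has an exponential `1 + h`, as the absolute value is trivial on the
rational numbers. -/
theorem exists_exp (hk : ∀ m : ℤ, m ≠ 0 → ‖(m : k)‖ = 1) {S : Subalgebra k (Alg lam)}
    (hS : IsClosed (S : Set (Alg lam))) {w : Alg lam} (hwS : w ∈ S) (hw : ‖w‖ < 1) :
    ∃ h ∈ S, ‖h‖ < 1 ∧ ∀ i, theta i h = (1 + h) * theta i w := by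
  have hfact : ∀ N : ℕ, ‖((N.factorial : k))⁻¹‖ = 1 := fun N => by
    have := hk N.factorial (by exact_mod_cast N.factorial_ne_zero)
    rw [norm_inv, inv_eq_one]
    exact_mod_cast this
  have hne : ∀ N : ℕ, ((N + 1 : ℕ) : k) ≠ 0 := fun N h => by
    have := hk (N + 1 : ℕ) (by exact_mod_cast N.succ_ne_zero)
    rw [Int.cast_natCast, h, norm_zero] at this
    exact zero_ne_one this
  let t : ℕ → Alg lam := fun N => ((N.factorial : k))⁻¹ • w ^ N
  have ht : ∀ N, ‖t N‖ ≤ ‖w‖ ^ N := fun N => by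
    rw [norm_smul', hfact, one_mul]
    exact norm_pow_le w N
  have hlim : Tendsto t cofinite (𝓝 0) := by
    rw [Nat.cofinite_eq_atTop]
    exact squeeze_zero_norm ht (tendsto_pow_atTop_nhds_zero_of_lt_one (norm_nonneg w) hw)
  have hsum : Summable t := NonarchimedeanAddGroup.summable_of_tendsto_cofinite_zero hlim
  have hsum' : Summable (fun N => t (N + 1)) := (summable_nat_add_iff 1).2 hsum
  have h0 : 1 + ∑' N, t (N + 1) = ∑' N, t N := by
    rw [hsum.tsum_eq_zero_add]
    simp [t]
  refine ⟨∑' N, t (N + 1), ?_, ?_, fun i => ?_⟩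
  · refine hS.mem_of_tendsto hsum'.hasSum (Filter.Eventually.of_forall fun s => ?_)
    exact S.sum_mem fun N _ => S.smul_mem (S.pow_mem hwS _) _
  · refine (IsUltrametricDist.norm_tsum_le_of_forall_le_of_nonneg (norm_nonneg w)
      (fun N => ?_)).trans_lt hw
    refine (ht (N + 1)).trans ?_
    exact pow_le_of_le_one (norm_nonneg w) hw.le N.succ_ne_zero
  · have hder : ∀ N, theta i (t (N + 1)) = t N * theta i w := fun N => by
      change theta i (((N + 1).factorial : k)⁻¹ • w ^ (N + 1)) = _
      rw [map_smul, ← thetaDer_apply i (w ^ (N + 1)), Derivation.leibniz_pow, thetaDer_apply,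
        Nat.add_sub_cancel, ← Nat.cast_smul_eq_nsmul k, smul_smul, Nat.factorial_succ,
        Nat.cast_mul, mul_inv_rev, inv_mul_cancel_right₀ (hne N), smul_eq_mul, ← smul_mul_assoc]
    have h1 := hsum'.hasSum.map (theta i : Alg lam →ₗ[k] Alg lam) (continuous_theta i)
    rw [h0, ← hsum.tsum_mul_right, ← h1.tsum_eq]
    exact tsum_congr hder

/-- A small series without terms free of `x_i` is the logarithmic derivative along `x_i` of a
series `1 + h` close to `1`. -/
theorem exists_theta_eq (hk : ∀ m : ℤ, m ≠ 0 → ‖(m : k)‖ = 1) {i : Fin n} {g : Alg lam}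
    (hg : ‖g‖ < 1) (hgi : ∀ m : Fin n → ℤ, m i = 0 → g.coeff m = 0)
    (hgS : g ∈ tailSubalgebra lam i) :
    ∃ h ∈ tailSubalgebra lam i, ‖h‖ < 1 ∧ theta i h = (1 + h) * g := by
  have hs : ∀ m : Fin n → ℤ, ‖((m i : k))⁻¹‖ ≤ 1 := fun m => by
    by_cases h : m i = 0
    · simp [h]
    · rw [norm_inv, hk _ h, inv_one]
  have hw : theta i (scaleCoeff (fun m => ((m i : k))⁻¹) hs g) = g := by
    ext m
    rw [coeff_theta, coeff_scaleCoeff]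
    by_cases h : m i = 0
    · rw [hgi m h, mul_zero, mul_zero]
    · refine mul_inv_cancel_left₀ (fun h0 => ?_) _
      have := hk _ h
      rw [h0, norm_zero] at this
      exact zero_ne_one this
  obtain ⟨h, hmem, hlt, hθ⟩ := exists_exp hk (isClosed_tailSubalgebra (lam := lam) i)
    (w := scaleCoeff (fun m => ((m i : k))⁻¹) hs g)
    (fun m hm => by rw [coeff_scaleCoeff, hgS m hm, mul_zero])
    ((norm_scaleCoeff_le _ hs g).trans_lt hg)
  exact ⟨h, hmem, hlt, by rw [hθ i, hw]⟩

/-- A series `1 + a` close to `1` with constant term `1` is a product of logarithmic derivatives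
along `x_1, …, x_n`: the `i`-th factor is the quotient of the parts of `1 + a` which depend on
`x_i, …, x_n` and on `x_{i+1}, …, x_n`, so that the product telescopes. -/
theorem exists_prod_eq (hk : ∀ m : ℤ, m ≠ 0 → ‖(m : k)‖ = 1) {a : Alg lam} (ha : ‖a‖ < 1)
    (ha0 : a.coeff 0 = 0) :
    ∃ h g : Fin n → Alg lam, (∀ i, (h i).DependsOnlyFrom i) ∧ (∀ i, ‖h i‖ < 1) ∧
      (∀ i, theta i (h i) = (1 + h i) * g i) ∧ ∏ i, (1 + g i) = 1 + a := by
  have hta : ∀ j, ‖tailPart j a‖ < 1 := fun j => (norm_tailPart_le j a).trans_lt ha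
  choose b hbS hb hb1 using fun j : ℕ => exists_inverse_mem
    (isClosed_tailSubalgebra (lam := lam) j) (tailPart_mem j a) (hta j)
  have hprod : ∀ N : ℕ, ∏ i ∈ Finset.range N, ((1 + tailPart i a) * b (i + 1)) =
      (1 + a) * b N := by
    intro N
    induction N with
    | zero =>
      have := hb 0
      rw [tailPart_zero] at this
      rw [Finset.prod_range_zero, this]
    | succ N ih =>
      rw [Finset.prod_range_succ, ih]
      linear_combination (1 + a) * b (N + 1) * hb N
  have hbn : b n = 1 := by
    have := hb n
    rwa [tailPart_eq_zero ha0, add_zero, one_mul] at this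
  let g : Fin n → Alg lam := fun i => (tailPart i a - tailPart (i + 1) a) * b (i + 1)
  have hg : ∀ i : Fin n, 1 + g i = (1 + tailPart i a) * b (i + 1) := fun i => by
    linear_combination -hb (i + 1)
  have hgnorm : ∀ i, ‖g i‖ < 1 := fun i => by
    refine (norm_mul_le _ _).trans_lt ?_
    refine (mul_le_of_le_one_right (norm_nonneg _) (hb1 _)).trans_lt ?_
    exact (norm_sub_le_max _ _).trans_lt (max_lt (hta _) (hta _))
  have hgS : ∀ i : Fin n, g i ∈ tailSubalgebra lam i := fun i =>
    (tailSubalgebra lam i).mul_mem ((tailSubalgebra lam i).sub_mem (tailPart_mem _ a)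
      (tailSubalgebra_anti (Nat.le_succ _) (tailPart_mem _ a)))
      (tailSubalgebra_anti (Nat.le_succ _) (hbS _))
  have hgi : ∀ (i : Fin n) (m : Fin n → ℤ), m i = 0 → (g i).coeff m = 0 := by
    intro i m hm
    rw [coeff_mul]
    refine (tsum_congr fun p => ?_).trans tsum_zero
    by_cases hp : p i = 0
    · rw [coeff_sub, coeff_tailPart, coeff_tailPart]
      have : (∃ l : Fin n, (l : ℕ) < i ∧ p l ≠ 0) ↔ ∃ l : Fin n, (l : ℕ) < i + 1 ∧ p l ≠ 0 := by
        refine ⟨fun ⟨l, hl, h⟩ => ⟨l, hl.trans (Nat.lt_succ_self _), h⟩, fun ⟨l, hl, h⟩ => ?_⟩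
        refine ⟨l, lt_of_le_of_ne (Nat.lt_succ_iff.1 hl) (fun e => ?_), h⟩
        rw [Fin.ext e] at h
        exact h hp
      rw [if_congr this rfl rfl, sub_self, zero_mul]
    · rw [hbS (i + 1) (m - p) ⟨i, Nat.lt_succ_self _, by simpa [hm] using hp⟩, mul_zero]
  choose h hS hlt hθ using fun i => exists_theta_eq hk (hgnorm i) (hgi i) (hgS i)
  refine ⟨h, g, hS, hlt, hθ, ?_⟩
  rw [Finset.prod_congr rfl fun i _ => hg i,
    Fin.prod_univ_eq_prod_range (fun i => (1 + tailPart i a) * b (i + 1)) n, hprod, hbn, mul_one]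

/-! ### Substitution automorphisms -/

theorem monomial_mul_monomial (p q : Fin n → ℤ) :
    (monomial p 1 : Alg lam) * monomial q 1 = monomial (p + q) 1 := by
  ext m
  rw [coeff_mul, tsum_eq_single p (fun s hs => by simp [coeff_monomial, hs])]
  simp [coeff_monomial, sub_eq_iff_eq_add']

theorem norm_monomial_le (m : Fin n → ℤ) : ‖(monomial m 1 : Alg lam)‖ ≤ weight lam m := by
  refine norm_le_of_forall (fun p => ?_)
  rw [coeff_monomial]
  split_ifs with h
  · rw [h, norm_one, one_mul]
  · rw [norm_zero, zero_mul]
    exact weight_nonneg lam m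

/-- The units at distance at most `ε < 1` from `1`. -/
def unitsNearOne (lam : Fin n → k) (ε : ℝ) (h0 : 0 ≤ ε) (h1 : ε < 1) : Subgroup (Alg lam)ˣ where
  carrier := {u | ‖(u : Alg lam) - 1‖ ≤ ε}
  one_mem' := by simpa using h0
  mul_mem' := by
    intro u v hu hv
    have hv1 : ‖(v : Alg lam)‖ ≤ 1 := by
      have := IsUltrametricDist.norm_add_le_max ((v : Alg lam) - 1) 1
      rw [sub_add_cancel, norm_one] at this
      exact this.trans (max_le (hv.trans h1.le) le_rfl)
    have e : ((u * v : (Alg lam)ˣ) : Alg lam) - 1 = ((u : Alg lam) - 1) * v + (v - 1) := by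
      push_cast; ring
    change ‖((u * v : (Alg lam)ˣ) : Alg lam) - 1‖ ≤ ε
    rw [e]
    refine (IsUltrametricDist.norm_add_le_max _ _).trans (max_le ?_ hv)
    exact (norm_mul_le _ _).trans ((mul_le_of_le_one_right (norm_nonneg _) hv1).trans hu)
  inv_mem' := by
    intro u hu
    have hle : ‖((u : Alg lam) - 1) * (u⁻¹ : (Alg lam)ˣ)‖ ≤ ε * ‖((u⁻¹ : (Alg lam)ˣ) : Alg lam)‖ :=
      (norm_mul_le _ _).trans (mul_le_mul_of_nonneg_right hu (norm_nonneg _))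
    have e : ((u⁻¹ : (Alg lam)ˣ) : Alg lam) - 1 = -(((u : Alg lam) - 1) * (u⁻¹ : (Alg lam)ˣ)) := by
      rw [sub_mul, Units.mul_inv]; ring
    have hinv : ‖((u⁻¹ : (Alg lam)ˣ) : Alg lam)‖ ≤ 1 := by
      by_contra! hlt
      have h2 := IsUltrametricDist.norm_add_le_max (((u⁻¹ : (Alg lam)ˣ) : Alg lam) - 1) 1
      rw [sub_add_cancel, norm_one, e, norm_neg] at h2
      refine absurd h2 (not_le.2 (max_lt (hle.trans_lt ?_) hlt))
      exact mul_lt_of_lt_one_left (zero_lt_one.trans hlt) h1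
    change ‖((u⁻¹ : (Alg lam)ˣ) : Alg lam) - 1‖ ≤ ε
    rw [e, norm_neg]
    exact hle.trans (mul_le_of_le_one_right h0 hinv)

theorem hasSum_monomial (f : Alg lam) :
    HasSum (fun m => f.coeff m • (monomial m 1 : Alg lam)) f := by
  have hs : Summable (fun m => f.coeff m • (monomial m 1 : Alg lam)) := by
    refine NonarchimedeanAddGroup.summable_of_tendsto_cofinite_zero
      (squeeze_zero_norm (fun m => ?_) f.tendsto_coeff)
    rw [norm_smul']
    exact mul_le_mul_of_nonneg_left (norm_monomial_le m) (norm_nonneg _)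
  convert hs.hasSum
  ext p
  rw [← coeffL_apply p (∑' m, f.coeff m • (monomial m 1 : Alg lam)), (coeffL p).map_tsum hs,
    tsum_eq_single p (fun m hm => by simp [coeff_monomial, hm.symm])]
  simp [coeff_monomial]

section Substitution

variable (T : (Fin n → ℤ) → Alg lam)

/-- The substitution `∑ c_m x^m ↦ ∑ c_m T_m`. -/
def subst (f : Alg lam) : Alg lam := ∑' m, f.coeff m • T m

variable {T} {ε : ℝ} (hT : ∀ m, ‖T m‖ ≤ weight lam m)
include hT

theorem summable_subst (f : Alg lam) : Summable (fun m => f.coeff m • T m) := by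
  refine NonarchimedeanAddGroup.summable_of_tendsto_cofinite_zero
    (squeeze_zero_norm (fun m => ?_) f.tendsto_coeff)
  rw [norm_smul']
  exact mul_le_mul_of_nonneg_left (hT m) (norm_nonneg _)

theorem subst_mul (hmul : ∀ p q, T (p + q) = T p * T q) (f g : Alg lam) :
    subst T (f * g) = subst T f * subst T g := by
  have hprod : Summable (fun s : (Fin n → ℤ) × (Fin n → ℤ) =>
      (f.coeff s.1 • T s.1) * (g.coeff s.2 • T s.2)) := by
    refine NonarchimedeanAddGroup.summable_of_tendsto_cofinite_zero ?_
    rw [Metric.tendsto_nhds]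
    intro δ hδ
    rw [Filter.eventually_cofinite]
    refine (f.finite_prod_le g hδ).subset (fun s hs => ?_)
    have hs' : δ ≤ ‖(f.coeff s.1 • T s.1) * (g.coeff s.2 • T s.2)‖ := by simpa using hs
    refine hs'.trans ((norm_mul_le _ _).trans ?_)
    rw [norm_smul', norm_smul']
    have h1 := mul_le_mul_of_nonneg_left (hT s.1) (norm_nonneg (f.coeff s.1))
    have h2 := mul_le_mul_of_nonneg_left (hT s.2) (norm_nonneg (g.coeff s.2))
    exact mul_le_mul h1 h2 (by positivity) (mul_nonneg (norm_nonneg _) (weight_nonneg lam _))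
  let e : (Fin n → ℤ) × (Fin n → ℤ) ≃ (Fin n → ℤ) × (Fin n → ℤ) :=
    { toFun := fun s => (s.2, s.1 - s.2)
      invFun := fun s => (s.1 + s.2, s.1)
      left_inv := fun s => by simp
      right_inv := fun s => by simp }
  have he : ∀ s, (f.coeff (e s).1 • T (e s).1) * (g.coeff (e s).2 • T (e s).2) =
      (f.coeff s.2 * g.coeff (s.1 - s.2)) • T s.1 := fun s => by
    change (f.coeff s.2 • T s.2) * (g.coeff (s.1 - s.2) • T (s.1 - s.2)) = _
    rw [smul_mul_smul_comm, ← hmul, add_sub_cancel]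
  have hprod' := e.summable_iff.2 hprod
  rw [subst, subst, subst,
    (summable_subst hT f).tsum_mul_tsum (summable_subst hT g) hprod, ← e.tsum_eq]
  simp only [Function.comp_def, he] at hprod' ⊢
  rw [hprod'.tsum_prod]
  refine tsum_congr (fun m => ?_)
  rw [coeff_mul]
  exact ((summable_conv f g m).tsum_smul_const (T m)).symm

theorem norm_subst_sub_le (hε : 0 ≤ ε) (hTε : ∀ m, ‖T m - monomial m 1‖ ≤ ε * weight lam m)
    (f : Alg lam) : ‖subst T f - f‖ ≤ ε * ‖f‖ := by
  have h := (summable_subst hT f).hasSum.sub f.hasSum_monomial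
  rw [subst, ← h.tsum_eq]
  refine IsUltrametricDist.norm_tsum_le_of_forall_le_of_nonneg
    (mul_nonneg hε (norm_nonneg f)) (fun m => ?_)
  rw [← smul_sub, norm_smul']
  calc ‖f.coeff m‖ * ‖T m - monomial m 1‖ ≤ ‖f.coeff m‖ * (ε * weight lam m) :=
        mul_le_mul_of_nonneg_left (hTε m) (norm_nonneg _)
    _ = ε * (‖f.coeff m‖ * weight lam m) := by ring
    _ ≤ ε * ‖f‖ := mul_le_mul_of_nonneg_left (f.term_le_norm m) hε

/-- The substitution as an algebra homomorphism, when `T` is multiplicative. -/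
def substHom (h1 : T 0 = 1) (hmul : ∀ p q, T (p + q) = T p * T q) : Alg lam →ₐ[k] Alg lam :=
  AlgHom.ofLinearMap
    { toFun := subst T
      map_add' := fun f g => by
        rw [subst, subst, subst, ← (summable_subst hT f).tsum_add (summable_subst hT g)]
        exact tsum_congr fun m => by rw [coeff_add, add_smul]
      map_smul' := fun c f => by
        rw [RingHom.id_apply, subst, subst, ← (summable_subst hT f).tsum_const_smul]
        exact tsum_congr fun m => by rw [coeff_smul, mul_smul] }
    (by
      change subst T 1 = 1
      rw [subst, tsum_eq_single 0 (fun m hm => by rw [coeff_one, if_neg hm, zero_smul]),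
        coeff_one, if_pos rfl, one_smul, h1])
    (subst_mul hT hmul)

end Substitution

/-- An endomorphism that differs from the identity by a map of norm less than `1` is an
automorphism: surjectivity is the fixed point theorem for the contraction
`g ↦ f + g - φ g`. -/
theorem exists_continuousAlgEquiv {φ : Alg lam →ₐ[k] Alg lam} {ε : ℝ} (h0 : 0 ≤ ε) (h1 : ε < 1)
    (hφ : ∀ f, ‖φ f - f‖ ≤ ε * ‖f‖) : ∃ e : Alg lam ≃A[k] Alg lam, ∀ f, e f = φ f := by
  have hnorm : ∀ f, ‖φ f‖ = ‖f‖ := by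
    intro f
    by_cases hf : f = 0
    · rw [hf, map_zero]
    · have hlt : ‖φ f - f‖ < ‖f‖ :=
        (hφ f).trans_lt (mul_lt_of_lt_one_left (norm_pos_iff.2 hf) h1)
      have := IsUltrametricDist.norm_add_eq_max_of_norm_ne_norm hlt.ne
      rwa [sub_add_cancel, max_eq_right hlt.le] at this
  have hiso : Isometry φ := AddMonoidHomClass.isometry_of_norm φ hnorm
  have hsurj : Function.Surjective φ := by
    intro f
    have hc : ContractingWith ⟨ε, h0⟩ (fun g => f + g - φ g) := by
      refine ⟨h1, LipschitzWith.of_dist_le_mul (fun a b => ?_)⟩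
      rw [dist_eq_norm, dist_eq_norm]
      have e : f + a - φ a - (f + b - φ b) = -(φ (a - b) - (a - b)) := by
        rw [map_sub]; ring
      rw [e, norm_neg]
      exact hφ (a - b)
    refine ⟨hc.fixedPoint, ?_⟩
    have := hc.fixedPoint_isFixedPt
    rw [Function.IsFixedPt] at this
    linear_combination -this
  let E := AlgEquiv.ofBijective φ ⟨hiso.injective, hsurj⟩
  exact ⟨{ E with
      continuous_toFun := hiso.continuous
      continuous_invFun :=
        (hiso.right_inv E.apply_symm_apply).continuous },
    fun f => rfl⟩

/-- For small `h`, the substitution `x_i ↦ x_i (1 + h i)` is an automorphism. -/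
theorem exists_substitution {h : Fin n → Alg lam} (hh : ∀ i, ‖h i‖ < 1) :
    ∃ φ : Alg lam ≃A[k] Alg lam, ∀ i, φ (X lam i) = X lam i * (1 + h i) := by
  have hε : ‖h‖ < 1 := (pi_norm_lt_iff one_pos).2 hh
  have hunit : ∀ i, ∃ u : (Alg lam)ˣ, (u : Alg lam) = 1 + h i := fun i => by
    have : IsUnit (1 - -h i) := isUnit_one_sub_of_norm_lt_one (by rw [norm_neg]; exact hh i)
    rw [sub_neg_eq_add] at this
    exact this
  choose U hU using hunit
  let V : (Fin n → ℤ) → (Alg lam)ˣ := fun m => ∏ i, U i ^ m i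
  have hV : ∀ m, ‖(V m : Alg lam) - 1‖ ≤ ‖h‖ := fun m =>
    (unitsNearOne lam ‖h‖ (norm_nonneg h) hε).prod_mem fun i _ =>
      (unitsNearOne lam ‖h‖ (norm_nonneg h) hε).zpow_mem
        (by
          change ‖(U i : Alg lam) - 1‖ ≤ ‖h‖
          rw [hU, add_sub_cancel_left]
          exact norm_le_pi_norm h i) _
  have hVadd : ∀ p q, V (p + q) = V p * V q := fun p q => by
    simp only [V, ← Finset.prod_mul_distrib, Pi.add_apply, zpow_add]
  have hVone : V 0 = 1 := by simp [V]
  have hVsingle : ∀ i, V (Pi.single i 1) = U i := fun i => by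
    rw [show V (Pi.single i 1) = ∏ j, U j ^ (Pi.single i 1 : Fin n → ℤ) j from rfl,
      Finset.prod_eq_single i (fun j _ hj => by rw [Pi.single_eq_of_ne hj, zpow_zero])
        (fun hi => absurd (Finset.mem_univ i) hi), Pi.single_eq_same, zpow_one]
  let T : (Fin n → ℤ) → Alg lam := fun m => monomial m 1 * (V m : Alg lam)
  have hTsub : ∀ m, ‖T m - monomial m 1‖ ≤ ‖h‖ * weight lam m := fun m => by
    rw [show T m - monomial m 1 = ((V m : Alg lam) - 1) * monomial m 1 by
      simp only [T]; ring]
    exact (norm_mul_le _ _).trans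
      (mul_le_mul (hV m) (norm_monomial_le m) (norm_nonneg _) (norm_nonneg _))
  have hT : ∀ m, ‖T m‖ ≤ weight lam m := fun m => by
    have := IsUltrametricDist.norm_add_le_max (T m - monomial m 1) (monomial m 1)
    rw [sub_add_cancel] at this
    refine this.trans (max_le ((hTsub m).trans ?_) (norm_monomial_le m))
    exact mul_le_of_le_one_left (weight_nonneg lam m) hε.le
  have hT0 : T 0 = 1 := by
    change (monomial 0 1 : Alg lam) * (V 0 : Alg lam) = 1
    rw [hVone, Units.val_one, mul_one]
    rfl
  have hTmul : ∀ p q, T (p + q) = T p * T q := fun p q => by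
    simp only [T, hVadd, Units.val_mul, ← monomial_mul_monomial]
    ring
  obtain ⟨e, he⟩ := exists_continuousAlgEquiv (φ := substHom hT hT0 hTmul) (norm_nonneg h) hε
    (norm_subst_sub_le hT (norm_nonneg h) hTsub)
  refine ⟨e, fun i => ?_⟩
  rw [he]
  change subst T (X lam i) = _
  rw [subst, tsum_eq_single (Pi.single i 1) (fun m hm => by
    rw [X, coeff_monomial, if_neg hm, zero_smul]), X, coeff_monomial, if_pos rfl, one_smul]
  simp only [T, hVsingle, hU]

end Alg

/-! ### Pulling back the standard form -/

theorem pullback_smul_stdForm {φ : Alg lam →ₐ[k] Alg lam} {h g : Fin n → Alg lam}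
    (hφ : ∀ i, φ (Alg.X lam i) = Alg.X lam i * (1 + h i))
    (hdep : ∀ i, (h i).DependsOnlyFrom i)
    (hg : ∀ i, Alg.theta i (h i) = (1 + h i) * g i) (c : k) :
    pullback φ (c • stdForm lam) =
      (algebraMap k (Alg lam) c * ∏ i, (1 + g i)) • stdForm lam := by
  rw [← formCoeff_smul_stdForm (pullback φ (c • stdForm lam))]
  congr 1
  have hc : formCoeff lam (c • stdForm lam) = algebraMap k (Alg lam) c := by
    rw [← algebraMap_smul (Alg lam) c (stdForm lam), map_smul, formCoeff_stdForm, smul_eq_mul,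
      mul_one]
  rw [pullback, map_smul, hc, AlgHom.commutes, smul_eq_mul, formCoeff,
    exteriorPower.alternatingMapLinearEquiv_apply_ιMulti]
  congr 1
  have hM : ∀ i j, (φ (Alg.Xinv lam i) • d lam (φ (Alg.X lam i)) : OneForm lam) j =
      φ (Alg.Xinv lam i) * Alg.theta j (Alg.X lam i * (1 + h i)) := fun i j => by
    rw [Pi.smul_apply, Alg.d_apply, smul_eq_mul, hφ]
  have hone : ∀ j, Alg.theta j (1 : Alg lam) = 0 := fun j => by
    rw [← Alg.thetaDer_apply, Derivation.map_one_eq_zero]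
  let M : Matrix (Fin n) (Fin n) (Alg lam) := Matrix.of fun i j =>
    φ (Alg.Xinv lam i) * Alg.theta j (Alg.X lam i * (1 + h i))
  have hMij : ∀ i j, M i j = φ (Alg.Xinv lam i) * Alg.theta j (Alg.X lam i * (1 + h i)) :=
    fun _ _ => rfl
  refine (congrArg Matrix.detRowAlternating (funext fun i => funext (hM i))).trans ?_
  change M.det = _
  rw [Matrix.det_of_isUpperTriangular]
  · refine Finset.prod_congr rfl (fun i _ => ?_)
    have h1 : φ (Alg.Xinv lam i) * (Alg.X lam i * (1 + h i)) = 1 := by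
      rw [← hφ, ← map_mul, mul_comm, Alg.X_mul_Xinv, map_one]
    rw [hMij, Alg.theta_mul, map_add, hone, zero_add, hg, Alg.theta_X, if_pos rfl]
    linear_combination (1 + g i) * h1
  · intro i j hij
    have hji : j < i := hij
    have hz : Alg.theta j (h i) = 0 := by
      ext m
      rw [Alg.coeff_theta, Alg.coeff_zero]
      by_cases hm : m j = 0
      · rw [hm, Int.cast_zero, zero_mul]
      · rw [hdep i m ⟨j, hji, hm⟩, mul_zero]
    rw [hMij, Alg.theta_mul, map_add, hone, zero_add, hz, Alg.theta_X, if_neg hji.ne, mul_zero,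
      mul_zero, zero_add, mul_zero]

end Polyannulus
end

theorem proposition9p10 {k₀ k : Type*} [Field k₀] [CharZero k₀] [NormedField k]
    [IsUltrametricDist k] [CompleteSpace k] [Algebra k₀ k]
    (hk₀ : ∀ a : k₀, a ≠ 0 → ‖algebraMap k₀ k a‖ = 1)
    (n : ℕ) (lam : Fin n → k) (hlam : ∀ i, lam i ≠ 0 ∧ ‖lam i‖ < 1)
    (f : Polyannulus.Alg lam)
    (hvol : Polyannulus.IsVolumeForm (f • Polyannulus.stdForm lam))
    (hsk : Polyannulus.formSkeleton (f • Polyannulus.stdForm lam) = Polyannulus.skeleton lam) :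
    ∃ (φ : Polyannulus.Alg lam ≃A[k] Polyannulus.Alg lam) (h : Fin n → Polyannulus.Alg lam)
      (c : k),
      (∀ i, φ (Polyannulus.Alg.X lam i) = Polyannulus.Alg.X lam i * (1 + h i)) ∧
      (∀ i, (h i).DependsOnlyFrom i) ∧
      (∀ i, Polyannulus.supNorm (h i) < 1) ∧
      (∀ (i : Fin n) (y : Polyannulus.Point lam), y.val (1 + h i) = 1) ∧
      Polyannulus.pullback (φ : Polyannulus.Alg lam →ₐ[k] Polyannulus.Alg lam)
          (c • Polyannulus.stdForm lam) = f • Polyannulus.stdForm lam ∧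
      (∀ (i : Fin n) (y : Polyannulus.Point lam),
        y.val (φ (Polyannulus.Alg.X lam i)) = y.val (Polyannulus.Alg.X lam i)) := by
  have hk : ∀ m : ℤ, m ≠ 0 → ‖(m : k)‖ = 1 := fun m hm => by
    have := hk₀ m (Int.cast_ne_zero.2 hm)
    rwa [map_intCast] at this
  have hlam0 : ∀ i, lam i ≠ 0 := fun i => (hlam i).1
  obtain ⟨g, hfg⟩ := Polyannulus.isUnit_of_isVolumeForm hvol
  set c := f.coeff 0 with hc
  have hfc : ‖f - algebraMap k (Polyannulus.Alg lam) c‖ < ‖c‖ :=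
    Polyannulus.Alg.norm_sub_coeff_zero_lt hlam hfg fun r hr =>
      -- the vertex of exponent `0` serves as the reference radius
      Polyannulus.gauss_eq_of_formSkeleton hlam0 hsk hr (Polyannulus.Alg.isRadius_vertex hlam 0)
  have hcpos : 0 < ‖c‖ := (norm_nonneg _).trans_lt hfc
  have hcne : c ≠ 0 := norm_pos_iff.1 hcpos
  obtain ⟨h, v, hdep, hlt, hθ, hprod⟩ := Polyannulus.Alg.exists_prod_eq hk
    (a := c⁻¹ • (f - algebraMap k (Polyannulus.Alg lam) c))
    (by
      rw [Polyannulus.Alg.norm_smul', norm_inv, inv_mul_lt_iff₀ hcpos, mul_one]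
      exact hfc)
    (by
      rw [Polyannulus.Alg.coeff_smul, Polyannulus.Alg.coeff_sub,
        Polyannulus.Alg.coeff_algebraMap, if_pos rfl, sub_self, mul_zero])
  obtain ⟨φ, hφ⟩ := Polyannulus.Alg.exists_substitution hlt
  refine ⟨φ, h, c, hφ, hdep, fun i => Polyannulus.supNorm_lt_one (hlt i),
    fun i y => y.val_one_add (hlt i), ?_, fun i y => ?_⟩
  · rw [Polyannulus.pullback_smul_stdForm hφ hdep hθ, hprod]
    congr 1
    rw [mul_add, mul_one, ← Algebra.smul_def, smul_smul, mul_inv_cancel₀ hcne, one_smul,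
      add_sub_cancel]
  · rw [hφ, map_mul, y.val_one_add (hlt i), mul_one]
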